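/- Let $X$ be a complex Banach space and let $A\colon\mathcal D(A)\subset X\to X$, $B\colon\mathcal D(B)\subset X\to X$ be linear operators such that $A$, $B$ and $A+B$ (with domain $\mathcal D(A)\cap\mathcal D(B)$) generate (strongly continuous) analytic semigroups, and such that $A$ and $B$ commute in the sense that $e^{tA}e^{tB}=e^{tB}e^{tA}$ for all $t\ge 0$. Let $g\colon X\to X$ be twice Fréchet differentiable (with respect to the real structure of $X$) with uniformly bounded first and second derivatives. Let $T>0$ and let $u\in C^2([0,T];X)$ be a solution of $$u'(t)=(A+B)u(t)+g(u(t)),\quad t\in[0,T],\qquad u(0)=u_0 .$$ For $\ell\ge1$ put $\varphi_\ell(\tau A)=\frac1{(\ell-1)!}\int_0^1\theta^{\ell-1}e^{(1-\theta)\tau A}\,d\theta$ (strong integral; similarly for $B$). For $\tau>0$ let $(u_n)_{n\ge0}$ be given by the scheme ERK2L started at $u_0$: $$U_{n2}=e^{\tau A}e^{\tau B}u_n+\tau\varphi_1(\tau A)\varphi_1(\tau B)g(u_n),\qquad u_{n+1}=U_{n2}+2\tau\varphi_2(\tau A)\varphi_2(\tau B)\bigl(g(U_{n2})-g(u_n)\bigr).$$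 Then there is a constant $C$, independent of $n$ and $\tau$ (but depending on $T$ and on the problem data), such that for all $\tau>0$ and all integers $n\ge0$ with $n\tau\le T$ the following bounds hold. (a) If $g(u(t))\in\mathcal D(BA)=\{v\in\mathcal D(A): Av\in\mathcal D(B)\}$ for all $t\in[0,T]$ and $\sup_{t\in[0,T]}\|BA\,g(u(t))\|<\infty$, then $\|u_n-u(n\tau)\|\le C\tau^2$. (b) If $g(u(t))\in\mathcal D(A)$ for all $t\in[0,T]$ and $\sup_{t\in[0,T]}\|A\,g(u(t))\|<\infty$, then $\|u_n-u(n\tau)\|\le C\tau^2(1+|\log\tau|)$. (c) Without any domain condition on $g(u(t))$ (in particular if $g(u(t))\notin\mathcal D(A)$), $\|u_n-u(n\tau)\|\le C\tau$. -/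

import Mathlib

open Set Filter Topology

namespace SplitExp

noncomputable section

/-- The open sector `{z ≠ 0 : |arg z| < δ}` of the complex plane. -/
def sector (δ : ℝ) : Set ℂ := {z : ℂ | z ≠ 0 ∧ |z.arg| < δ}

/-- `S : [0,∞) → L(X)` is a strongly continuous semigroup (values at negative times are
irrelevant). -/
structure IsC0Semigroup {X : Type*} [NormedAddCommGroup X] [NormedSpace ℂ X]
    (S : ℝ → X →L[ℂ] X) : Prop where
  zero : S 0 = ContinuousLinearMap.id ℂ X
  add : ∀ s t : ℝ, 0 ≤ s → 0 ≤ t → S (s + t) = (S s).comp (S t)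
  cont : ∀ x : X, ContinuousOn (fun t : ℝ => S t x) (Ici 0)

/-- `(T z)`, `z ∈ sector δ ∪ {0}`, is an analytic semigroup of angle `δ`. -/
structure IsAnalyticSemigroupOfAngle {X : Type*} [NormedAddCommGroup X] [NormedSpace ℂ X]
    (δ : ℝ) (T : ℂ → X →L[ℂ] X) : Prop where
  zero : T 0 = ContinuousLinearMap.id ℂ X
  add : ∀ z ∈ sector δ, ∀ w ∈ sector δ, T (z + w) = (T z).comp (T w)
  holo : DifferentiableOn ℂ T (sector δ)
  tendsto_zero : ∀ δ' : ℝ, 0 < δ' → δ' < δ → ∀ x : X,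
    Tendsto (fun z : ℂ => T z x) (𝓝[sector δ'] 0) (𝓝 x)

/-- `A` is the infinitesimal generator of `S`: its domain consists of those `x` for which
`(S t x - x) / t` converges as `t → 0+`, and `A x` is the limit. -/
def IsGenerator {X : Type*} [NormedAddCommGroup X] [NormedSpace ℂ X]
    (A : X →ₗ.[ℂ] X) (S : ℝ → X →L[ℂ] X) : Prop :=
  ∀ x y : X, (∃ hx : x ∈ A.domain, A ⟨x, hx⟩ = y) ↔
    Tendsto (fun t : ℝ => t⁻¹ • (S t x - x)) (𝓝[>] 0) (𝓝 y)

/-- The (possibly unbounded) operator `A` generates the strongly continuous semigroup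
`S t = exp (t A)`, `t ≥ 0`, and this semigroup is analytic, that is, the restriction to `[0,∞)`
of an analytic semigroup of some angle `δ ∈ (0, π/2]`. -/
def GeneratesAnalyticSemigroup {X : Type*} [NormedAddCommGroup X] [NormedSpace ℂ X]
    (A : X →ₗ.[ℂ] X) (S : ℝ → X →L[ℂ] X) : Prop :=
  IsC0Semigroup S ∧ IsGenerator A S ∧
    ∃ δ : ℝ, 0 < δ ∧ δ ≤ Real.pi / 2 ∧ ∃ T : ℂ → X →L[ℂ] X,
      IsAnalyticSemigroupOfAngle δ T ∧ ∀ t : ℝ, 0 ≤ t → T (t : ℂ) = S t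

/-- `phi S l t x = φ_l (t A) x`, where `S t = exp (t A)`: `φ_0 (t A) = exp (t A)` and
`φ_l (t A) x = 1 / (l - 1)! * ∫_0^1 θ ^ (l - 1) exp ((1 - θ) t A) x dθ` for `l ≥ 1`. -/
def phi {X : Type*} [NormedAddCommGroup X] [NormedSpace ℂ X]
    (S : ℝ → X →L[ℂ] X) : ℕ → ℝ → X → X
  | 0, t, x => S t x
  | l + 1, t, x =>
      ((Nat.factorial l : ℕ) : ℝ)⁻¹ • ∫ θ in (0 : ℝ)..1, θ ^ l • S ((1 - θ) * t) x

/-- The internal stage `U_{n2}` of the scheme, computed from `v = u_n`. -/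
def stage {X : Type*} [NormedAddCommGroup X] [NormedSpace ℂ X]
    (SA SB : ℝ → X →L[ℂ] X) (g : X → X) (τ : ℝ) (v : X) : X :=
  SA τ (SB τ v) + τ • phi SA 1 τ (phi SB 1 τ (g v))

/-- One step `u_n ↦ u_{n+1}` of the scheme. -/
def step {X : Type*} [NormedAddCommGroup X] [NormedSpace ℂ X]
    (SA SB : ℝ → X →L[ℂ] X) (g : X → X) (τ : ℝ) (v : X) : X :=
  stage SA SB g τ v +
    (2 * τ) • phi SA 2 τ (phi SB 2 τ (g (stage SA SB g τ v) - g v))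

/-- The numerical solution `u_n` of the split exponential integrator ERK2L with step size `τ`
and initial value `u₀`. -/
def erk2l {X : Type*} [NormedAddCommGroup X] [NormedSpace ℂ X]
    (SA SB : ℝ → X →L[ℂ] X) (g : X → X) (τ : ℝ) (u₀ : X) : ℕ → X
  | 0 => u₀
  | n + 1 => step SA SB g τ (erk2l SA SB g τ u₀ n)

/-- `u` solves `u' = L u + g (u)` on `[0,T]` with `u 0 = u₀`, in the classical sense (one-sided
derivatives at the end points). -/
def IsSolution {X : Type*} [NormedAddCommGroup X] [NormedSpace ℂ X]
    (L : X →ₗ.[ℂ] X) (g : X → X) (T : ℝ) (u₀ : X) (u : ℝ → X) : Prop :=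
  u 0 = u₀ ∧ ∀ t ∈ Icc (0 : ℝ) T, ∃ ht : u t ∈ L.domain,
    HasDerivWithinAt u (L ⟨u t, ht⟩ + g (u t)) (Icc 0 T) t

/-- `g` is twice Fréchet differentiable (over the reals) with uniformly bounded first and second
derivatives. -/
def TwiceDiffBounded {X : Type*} [NormedAddCommGroup X] [NormedSpace ℂ X] (g : X → X) : Prop :=
  Differentiable ℝ g ∧ Differentiable ℝ (fderiv ℝ g) ∧
    (∃ K : ℝ, ∀ x : X, ‖fderiv ℝ g x‖ ≤ K) ∧
    ∃ K : ℝ, ∀ x : X, ‖fderiv ℝ (fderiv ℝ g) x‖ ≤ K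

/-- `h t ∈ D(A)` for all `t ∈ [0,T]`, with `A (h t)` bounded uniformly in `t`. -/
def BoundedInDomain {X : Type*} [NormedAddCommGroup X] [NormedSpace ℂ X]
    (A : X →ₗ.[ℂ] X) (T : ℝ) (h : ℝ → X) : Prop :=
  ∃ M : ℝ, ∀ t ∈ Icc (0 : ℝ) T, ∃ h₁ : h t ∈ A.domain, ‖A ⟨h t, h₁⟩‖ ≤ M

/-- `h t ∈ D(BA)`, that is `h t ∈ D(A)` and `A (h t) ∈ D(B)`, for all `t ∈ [0,T]`, with
`B (A (h t))` bounded uniformly in `t`. -/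
def BoundedInDomainComp {X : Type*} [NormedAddCommGroup X] [NormedSpace ℂ X]
    (B A : X →ₗ.[ℂ] X) (T : ℝ) (h : ℝ → X) : Prop :=
  ∃ M : ℝ, ∀ t ∈ Icc (0 : ℝ) T, ∃ h₁ : h t ∈ A.domain, ∃ h₂ : A ⟨h t, h₁⟩ ∈ B.domain,
    ‖B ⟨A ⟨h t, h₁⟩, h₂⟩‖ ≤ M

end

end SplitExp

/-!
Write `a t = SA t`, `b t = SB t`, `P t = a t ∘ b t` and `f t = g (u t)`. The families `a` and `b`
commute at all pairs of times (`IsC0Semigroup.commute`), so `P` is a strongly continuous semigroup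
whose generator is `A + B` on `D(A) ∩ D(B)`; this suffices for the variation-of-constants formula
`IsC0Semigroup.variation_of_constants`, in which only `P` occurs.

Replacing `φ_l(τ(A + B))` by `l! φ_l(τA) φ_l(τB)` is the only source of order reduction. This
defect is a covariance: `norm_covariance_le` rests on the identity
`(∫ w F)(∫ w G) - (∫ w)(∫ w F G) = -1/2 ∫∫ w(θ) w(σ) (F θ - F σ)(G θ - G σ)`. Hence the defect is
controlled by the products `(a s - a r)(b s - b r)` with `s, r ∈ [0, τ]`, and no unbounded operator
has to be handled. Preceded by `P (j τ)`, such a product is bounded by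
* `C / (j + 1)^2` in general, because `‖a (j τ) (a s - a r)‖ ≤ C / (j + 1)` by analyticity, and
  likewise for `b` (`exists_norm_increments_le`);
* `C τ / (j + 1)` on `D(A)` (`exists_norm_increments_le_of_mem_domain`);
* `C τ^2` on `D(BA)` (`exists_norm_increments_le_of_mem_domain_comp`).

The local error is `τ` times the defect of `φ_1` applied to `f t`, plus `τ` times the defect of
`φ_2` applied to `f (t + τ) - f t = O(τ)`, plus a remainder (`exists_norm_local_error_le`).
Summed over the steps, the `φ_2` part is `τ^2 ∑ (j + 1)^(-2) = O(τ^2)` without any condition on the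
domain, while the `φ_1` part is `τ ∑ (j + 1)^(-2)`, `τ^2 ∑ (j + 1)^(-1)` or `τ^2 ∑ τ` in the three
situations: this yields the orders `τ`, `τ^2 (1 + |log τ|)` and `τ^2`. The passage from local to
global errors is a discrete Gronwall argument (`norm_le_of_error_recursion`,
`exists_norm_global_error_le`).
-/

namespace SplitExp

variable {X : Type*} [NormedAddCommGroup X] [NormedSpace ℂ X]

/-! ### Strongly continuous families of operators -/

/-- Joint continuity of operator application for a bounded, strongly convergent family. -/
theorem tendsto_clm_apply {ι : Type*} {l : Filter ι} {F : ι → X →L[ℂ] X} {v : ι → X} {y z : X}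
    {M : ℝ} (hM : ∀ᶠ i in l, ‖F i‖ ≤ M) (hF : Tendsto (fun i => F i y) l (𝓝 z))
    (hv : Tendsto v l (𝓝 y)) : Tendsto (fun i => F i (v i)) l (𝓝 z) := by
  have h0 : Tendsto (fun i => F i (v i - y)) l (𝓝 0) := by
    have h1 : Tendsto (fun i => M * ‖v i - y‖) l (𝓝 0) := by
      simpa using (tendsto_iff_norm_sub_tendsto_zero.1 hv).const_mul M
    refine squeeze_zero_norm' ?_ h1
    filter_upwards [hM] with i hi using (F i).le_of_opNorm_le hi _
  simpa using h0.add hF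

theorem continuousOn_clm_apply {Y : Type*} [TopologicalSpace Y] {s : Set Y} {F : Y → X →L[ℂ] X}
    {v : Y → X} {M : ℝ} (hM : ∀ t ∈ s, ‖F t‖ ≤ M) (hF : ∀ x, ContinuousOn (fun t => F t x) s)
    (hv : ContinuousOn v s) : ContinuousOn (fun t => F t (v t)) s := fun t ht =>
  tendsto_clm_apply (eventually_mem_nhdsWithin.mono hM) (hF (v t) t ht) (hv t ht)

theorem exists_norm_le_of_isCompact [CompleteSpace X] {Y : Type*} [TopologicalSpace Y] {s : Set Y}
    (hs : IsCompact s) {F : Y → X →L[ℂ] X} (hF : ∀ x, ContinuousOn (fun t => F t x) s) :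
    ∃ M : ℝ, ∀ t ∈ s, ‖F t‖ ≤ M := by
  obtain ⟨M, hM⟩ := banach_steinhaus (g := fun t : s => F t) fun x => by
    obtain ⟨C, hC⟩ := hs.exists_bound_of_continuousOn (hF x)
    exact ⟨C, fun t => hC t t.2⟩
  exact ⟨M, fun t ht => hM ⟨t, ht⟩⟩

/-! ### Strongly continuous semigroups -/

theorem IsC0Semigroup.exists_norm_le [CompleteSpace X] {S : ℝ → X →L[ℂ] X} (hS : IsC0Semigroup S)
    (T : ℝ) : ∃ M : ℝ, ∀ t ∈ Icc (0 : ℝ) T, ‖S t‖ ≤ M :=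
  exists_norm_le_of_isCompact isCompact_Icc fun x => (hS.cont x).mono Icc_subset_Ici_self

theorem IsC0Semigroup.apply_add {S : ℝ → X →L[ℂ] X} (hS : IsC0Semigroup S) {s t : ℝ}
    (hs : 0 ≤ s) (ht : 0 ≤ t) (x : X) : S (s + t) x = S s (S t x) := by
  rw [hS.add s t hs ht]; rfl

theorem IsC0Semigroup.natCast_mul {S : ℝ → X →L[ℂ] X} (hS : IsC0Semigroup S) {h : ℝ}
    (hh : 0 ≤ h) (n : ℕ) : S (n * h) = S h ^ n := by
  induction n with
  | zero => simp [hS.zero]; rfl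
  | succ n ih =>
    rw [Nat.cast_succ, add_mul, one_mul, hS.add _ _ (by positivity) hh, ih, pow_succ]; rfl

theorem IsC0Semigroup.apply_comm {S : ℝ → X →L[ℂ] X} (hS : IsC0Semigroup S) {s t : ℝ}
    (hs : 0 ≤ s) (ht : 0 ≤ t) (x : X) : S s (S t x) = S t (S s x) := by
  rw [← hS.apply_add hs ht, ← hS.apply_add ht hs, add_comm]

/-- Semigroups which commute at equal times commute at all times: the times may first be taken
commensurable, where both operators are powers of operators at a common time. -/
theorem IsC0Semigroup.commute {S R : ℝ → X →L[ℂ] X} (hS : IsC0Semigroup S) (hR : IsC0Semigroup R)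
    (hcomm : ∀ t : ℝ, 0 ≤ t → (S t).comp (R t) = (R t).comp (S t)) {s t : ℝ} (hs : 0 ≤ s)
    (ht : 0 ≤ t) (x : X) : S s (R t x) = R t (S s x) := by
  rcases hs.eq_or_lt with rfl | hs'
  · simp [hS.zero]
  -- Approximate `t` by rational multiples `r n` of `s`.
  let r : ℕ → ℝ := fun n => (⌊t / s * n⌋₊ : ℝ) / n * s
  have hr0 : ∀ n, 0 ≤ r n := fun n => by positivity
  have hr : Tendsto r atTop (𝓝[Ici 0] t) := by
    refine tendsto_nhdsWithin_iff.2 ⟨?_, Eventually.of_forall hr0⟩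
    have h := ((tendsto_nat_floor_mul_div_atTop (R := ℝ) (a := t / s) (by positivity)).comp
      tendsto_natCast_atTop_atTop).mul_const s
    rwa [div_mul_cancel₀ _ hs'.ne'] at h
  have key : ∀ᶠ n in atTop, S s (R (r n) x) = R (r n) (S s x) := by
    filter_upwards [eventually_gt_atTop 0] with n hn
    have hn' : (n : ℝ) ≠ 0 := by exact_mod_cast hn.ne'
    have hh : 0 ≤ s / n := by positivity
    have e1 : S s = S (s / n) ^ n := by
      rw [← hS.natCast_mul hh, mul_div_cancel₀ _ hn']
    have e2 : R (r n) = R (s / n) ^ ⌊t / s * n⌋₊ := by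
      rw [← hR.natCast_mul hh]; congr 1; simp only [r]; ring
    have hc : Commute (S (s / n)) (R (s / n)) := hcomm _ hh
    have := hc.pow_pow n ⌊t / s * n⌋₊
    rw [← e1, ← e2] at this
    exact DFunLike.congr_fun this x
  have l1 : Tendsto (fun n => S s (R (r n) x)) atTop (𝓝 (S s (R t x))) :=
    ((S s).continuous.tendsto _).comp ((hR.cont x t ht).tendsto.comp hr)
  have l2 : Tendsto (fun n => R (r n) (S s x)) atTop (𝓝 (R t (S s x))) :=
    (hR.cont (S s x) t ht).tendsto.comp hr
  exact tendsto_nhds_unique_of_eventuallyEq l1 l2 key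

/-- The product of two commuting semigroups is a semigroup. -/
theorem IsC0Semigroup.comp [CompleteSpace X] {S R : ℝ → X →L[ℂ] X} (hS : IsC0Semigroup S)
    (hR : IsC0Semigroup R)
    (hcomm : ∀ t : ℝ, 0 ≤ t → (S t).comp (R t) = (R t).comp (S t)) :
    IsC0Semigroup fun t => (S t).comp (R t) where
  zero := by simp [hS.zero, hR.zero]
  add s t hs ht := by
    ext x
    simp only [ContinuousLinearMap.comp_apply]
    rw [hS.apply_add hs ht, hR.apply_add hs ht, hS.commute hR hcomm ht hs]
  cont x := by
    intro t ht
    obtain ⟨M, hM⟩ := hS.exists_norm_le (t + 1)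
    refine tendsto_clm_apply (F := S) (v := fun s => R s x) (M := M) ?_ (hS.cont (R t x) t ht)
      (hR.cont x t ht)
    filter_upwards [eventually_mem_nhdsWithin, nhdsWithin_le_nhds (Iio_mem_nhds (lt_add_one t))]
      with s hs hs' using hM s ⟨hs, (mem_Iio.1 hs').le⟩

/-- If the right derivative at `0` of `t ↦ S t x` is `y`, then `t ↦ S t x` has right derivative
`S t y` everywhere. -/
theorem IsC0Semigroup.hasDerivWithinAt_Ioi {S : ℝ → X →L[ℂ] X} (hS : IsC0Semigroup S) {x y : X}
    (h : Tendsto (fun t : ℝ => t⁻¹ • (S t x - x)) (𝓝[>] 0) (𝓝 y)) {t : ℝ} (ht : 0 ≤ t) :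
    HasDerivWithinAt (fun s => S s x) (S t y) (Ioi t) t := by
  rw [hasDerivWithinAt_iff_tendsto_slope' self_notMem_Ioi]
  have hsub : Tendsto (fun s : ℝ => s - t) (𝓝[>] t) (𝓝[>] 0) := by
    refine tendsto_nhdsWithin_iff.2 ⟨?_, ?_⟩
    · have : Tendsto (fun s : ℝ => s - t) (𝓝 t) (𝓝 (t - t)) := by
        exact (continuous_id.sub continuous_const).tendsto t
      rw [sub_self] at this
      exact this.mono_left nhdsWithin_le_nhds
    · filter_upwards [eventually_mem_nhdsWithin] with s hs using sub_pos.2 (mem_Ioi.1 hs)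
  refine (((S t).continuous.tendsto y).comp (h.comp hsub)).congr' ?_
  filter_upwards [eventually_mem_nhdsWithin] with s hs
  have hs' : 0 ≤ s - t := (sub_pos.2 (mem_Ioi.1 hs)).le
  have : S s x = S t (S (s - t) x) := by rw [← hS.apply_add ht hs', add_sub_cancel]
  simp only [Function.comp, slope_def_module, this,
    ContinuousLinearMap.map_smul_of_tower, map_sub]

/-- A bound for increments `L (S s x) - L (S r x)` when `x` lies in the domain of the generator;
`y` stands for the generator applied to `x`. -/
theorem IsC0Semigroup.norm_apply_sub_le {S : ℝ → X →L[ℂ] X} (hS : IsC0Semigroup S) {x y : X}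
    (h : Tendsto (fun t : ℝ => t⁻¹ • (S t x - x)) (𝓝[>] 0) (𝓝 y)) (L : X →L[ℂ] X) {τ K : ℝ}
    (hK : ∀ σ ∈ Icc 0 τ, ‖L (S σ y)‖ ≤ K) {s r : ℝ} (hs : s ∈ Icc 0 τ) (hr : r ∈ Icc 0 τ) :
    ‖L ((S s - S r) x)‖ ≤ K * τ := by
  wlog hrs : r ≤ s generalizing s r
  · have := this hr hs (le_of_not_ge hrs)
    rwa [← norm_neg, ← map_neg, ← neg_apply, neg_sub] at this
  have hK0 : 0 ≤ K := (norm_nonneg _).trans (hK s hs)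
  have := norm_image_sub_le_of_norm_deriv_right_le_segment (f := fun σ => L (S σ x))
    (f' := fun σ => L (S σ y)) (a := r) (b := s) (C := K)
    (L.continuous.comp_continuousOn ((hS.cont x).mono fun σ hσ => hr.1.trans hσ.1))
    (fun σ hσ => ((L.restrictScalars ℝ).hasFDerivAt.comp_hasDerivWithinAt σ
      (hS.hasDerivWithinAt_Ioi h (hr.1.trans hσ.1))).Ici_of_Ioi)
    (fun σ hσ => hK σ ⟨hr.1.trans hσ.1, hσ.2.le.trans hs.2⟩) s ⟨hrs, le_rfl⟩
  rw [sub_apply, map_sub]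
  refine this.trans (mul_le_mul_of_nonneg_left ?_ hK0)
  linarith [hr.1, hs.2]

/-! ### Smoothing by analytic semigroups -/

/-- An analytic semigroup is bounded on the discs with centre `t` and radius `c * t`,
`0 < t ≤ T`, for a suitable `c`. -/
theorem IsAnalyticSemigroupOfAngle.exists_norm_le [CompleteSpace X] {δ : ℝ} {E : ℂ → X →L[ℂ] X}
    (hδ : 0 < δ) (hE : IsAnalyticSemigroupOfAngle δ E) (T : ℝ) :
    ∃ c > 0, ∃ M : ℝ, ∀ t ∈ Ioc (0 : ℝ) T, ∀ w ∈ Metric.closedBall (1 : ℂ) c,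
      (t * w : ℂ) ∈ sector δ ∧ ‖E (t * w)‖ ≤ M := by
  have hδ2 : 0 < δ / 2 := by positivity
  have hnear : sector (δ / 2) ∈ 𝓝 (1 : ℂ) := by
    have h1 : ∀ᶠ z : ℂ in 𝓝 1, |z.arg| < δ / 2 := by
      have := (Complex.continuousAt_arg (x := 1) (by simp)).abs
      refine this.tendsto.eventually_lt_const ?_
      simpa using hδ2
    filter_upwards [h1, isOpen_ne.mem_nhds (one_ne_zero (α := ℂ))] with z h1 h2 using ⟨h2, h1⟩
  obtain ⟨c, hc, hball⟩ := Metric.nhds_basis_closedBall.mem_iff.1 hnear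
  have hmul : ∀ t : ℝ, 0 < t → ∀ w ∈ Metric.closedBall (1 : ℂ) c, (t * w : ℂ) ∈ sector (δ / 2) := by
    intro t ht w hw
    obtain ⟨h1, h2⟩ := hball hw
    exact ⟨mul_ne_zero (by exact_mod_cast ht.ne') h1, by rwa [Complex.arg_real_mul w ht]⟩
  have hsub : sector (δ / 2) ⊆ sector δ := fun z hz => ⟨hz.1, hz.2.trans (by linarith)⟩
  obtain ⟨M, hM⟩ := banach_steinhaus
    (g := fun p : {p : ℝ × ℂ // p ∈ Ioc 0 T ×ˢ Metric.closedBall (1 : ℂ) c} =>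
      E (p.1.1 * p.1.2)) fun x => by
    obtain ⟨r, hr, hrx⟩ : ∃ r > 0, ∀ z ∈ sector (δ / 2), ‖z‖ < r → ‖E z x‖ ≤ ‖x‖ + 1 := by
      have h1 := (hE.tendsto_zero (δ / 2) hδ2 (by linarith) x).norm.eventually_le_const
        (lt_add_one ‖x‖)
      obtain ⟨r, hr, h⟩ := Metric.mem_nhdsWithin_iff.1 h1
      exact ⟨r, hr, fun z hz hzr => h ⟨by simpa using hzr, hz⟩⟩
    -- For `t < r / (1 + c)` the points `t * w` lie in the ball of radius `r` about `0`; the remaining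
    -- ones form a compact set.
    have hcpt : IsCompact (Icc (r / (1 + c)) T ×ˢ Metric.closedBall (1 : ℂ) c) :=
      isCompact_Icc.prod (isCompact_closedBall _ _)
    obtain ⟨C, hC⟩ := hcpt.exists_bound_of_continuousOn
      (f := fun p : ℝ × ℂ => E (p.1 * p.2) x) (by
        have h1 : ContinuousOn (fun z => E z x) (sector δ) :=
          hE.holo.continuousOn.clm_apply continuousOn_const
        refine h1.comp (by fun_prop) fun p hp => hsub (hmul p.1 ?_ p.2 hp.2)
        exact lt_of_lt_of_le (by positivity) hp.1.1)
    refine ⟨max C (‖x‖ + 1), fun ⟨⟨t, w⟩, ht, hw⟩ => ?_⟩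
    rcases lt_or_ge t (r / (1 + c)) with h | h
    · refine (hrx _ (hmul t ht.1 w hw) ?_).trans (le_max_right _ _)
      have hw1 : ‖w‖ ≤ 1 + c := by
        have h2 : ‖w - 1‖ ≤ c := by simpa [dist_eq_norm] using hw
        calc ‖w‖ = ‖1 + (w - 1)‖ := by congr 1; ring
          _ ≤ ‖(1 : ℂ)‖ + ‖w - 1‖ := norm_add_le _ _
          _ ≤ 1 + c := by simpa using h2
      have ht0 : (0 : ℝ) < t := ht.1
      rw [norm_mul, Complex.norm_real, Real.norm_of_nonneg ht0.le]
      calc t * ‖w‖ ≤ t * (1 + c) := by gcongr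
        _ < r := (lt_div_iff₀ (by positivity)).1 h
    · exact (hC (t, w) ⟨⟨h, ht.2⟩, hw⟩).trans (le_max_left _ _)
  exact ⟨c, hc, M, fun t ht w hw => ⟨hsub (hmul t ht.1 w hw), hM ⟨(t, w), ht, hw⟩⟩⟩

/-- The parabolic smoothing estimate `‖A exp (t A)‖ ≤ C / t`, in integrated form. It follows from
Cauchy's estimate on discs whose radius is proportional to `t`. -/
theorem GeneratesAnalyticSemigroup.exists_norm_sub_le [CompleteSpace X] {A : X →ₗ.[ℂ] X}
    {S : ℝ → X →L[ℂ] X} (hA : GeneratesAnalyticSemigroup A S) (T : ℝ) :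
    ∃ C : ℝ, 0 ≤ C ∧ ∀ r s : ℝ, 0 < r → r ≤ s → s ≤ T → ‖S s - S r‖ ≤ C / r * (s - r) := by
  obtain ⟨-, -, δ, hδ, -, E, hE, hES⟩ := hA
  obtain ⟨c, hc, M, hM⟩ := hE.exists_norm_le hδ T
  have hder : ∀ t ∈ Ioc (0 : ℝ) T, HasDerivAt (fun s : ℝ => E s) (deriv E t) t ∧
      ‖deriv E t‖ ≤ M / (c * t) := by
    intro t ht
    have ht0 : 0 < t := ht.1
    have hR : 0 < c * t := by positivity
    have hmem : ∀ z ∈ Metric.closedBall (t : ℂ) (c * t), z ∈ sector δ ∧ ‖E z‖ ≤ M := by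
      intro z hz
      have htC : (t : ℂ) ≠ 0 := by exact_mod_cast ht0.ne'
      have hw : z / t ∈ Metric.closedBall (1 : ℂ) c := by
        rw [mem_closedBall_iff_norm] at hz ⊢
        have : z / t - 1 = (z - t) / t := by field_simp
        rwa [this, norm_div, Complex.norm_real, Real.norm_of_nonneg ht0.le, div_le_iff₀ ht0]
      have := hM t ht _ hw
      rwa [mul_div_cancel₀ _ htC] at this
    have hdiff : DifferentiableOn ℂ E (Metric.closedBall (t : ℂ) (c * t)) :=
      hE.holo.mono fun z hz => (hmem z hz).1
    constructor
    · have h1 : HasDerivAt E (deriv E t) (t : ℂ) :=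
        (hdiff.differentiableAt (Metric.closedBall_mem_nhds _ hR)).hasDerivAt
      have h2 := HasDerivAt.scomp t h1 Complex.ofRealCLM.hasDerivAt
      rw [Complex.ofRealCLM_apply, Complex.ofReal_one, one_smul] at h2
      exact h2
    · refine Complex.norm_deriv_le_of_forall_mem_sphere_norm_le hR
        (DifferentiableOn.diffContOnCl ?_) fun z hz =>
          (hmem z (Metric.sphere_subset_closedBall hz)).2
      rwa [closure_ball _ hR.ne']
  refine ⟨|M| / c, by positivity, fun r s hr hrs hs => ?_⟩
  rw [← hES s (hr.le.trans hrs), ← hES r hr.le]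
  have := Convex.norm_image_sub_le_of_norm_hasDerivWithin_le (f := fun s : ℝ => E s)
    (f' := fun t : ℝ => deriv E t) (s := Icc r s) (C := |M| / c / r)
    (fun t ht => (hder t ⟨hr.trans_le ht.1, ht.2.trans hs⟩).1.hasDerivWithinAt)
    (fun t ht => (hder t ⟨hr.trans_le ht.1, ht.2.trans hs⟩).2.trans ?_) (convex_Icc r s)
    (left_mem_Icc.2 hrs) (right_mem_Icc.2 hrs)
  · rwa [Real.norm_of_nonneg (sub_nonneg.2 hrs)] at this
  · rw [div_div]
    have : 0 < r := hr
    gcongr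
    · exact le_abs_self M
    · exact ht.1

/-- Smoothing along a time grid: increments over one step lose a factor `j + 1` after `j` steps.
The case `j = 0` is mere boundedness. -/
theorem GeneratesAnalyticSemigroup.exists_norm_comp_sub_le [CompleteSpace X] {A : X →ₗ.[ℂ] X}
    {S : ℝ → X →L[ℂ] X} (hA : GeneratesAnalyticSemigroup A S) (T : ℝ) :
    ∃ C : ℝ, 0 ≤ C ∧ ∀ τ : ℝ, 0 < τ → ∀ j : ℕ, (j + 1) * τ ≤ T →
      ∀ s ∈ Icc 0 τ, ∀ r ∈ Icc 0 τ, ‖(S (j * τ)).comp (S s - S r)‖ ≤ C / (j + 1) := by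
  obtain ⟨C, hC0, hC⟩ := hA.exists_norm_sub_le T
  obtain ⟨M, hM⟩ := hA.1.exists_norm_le T
  refine ⟨max (2 * C) (2 * |M|), by positivity, fun τ hτ j hj s hs r hr => ?_⟩
  wlog hrs : r ≤ s generalizing s r
  · have := this r hr s hs (le_of_not_ge hrs)
    rwa [← norm_neg, ← ContinuousLinearMap.comp_neg, neg_sub] at this
  have e : (S (j * τ)).comp (S s - S r) = S (j * τ + s) - S (j * τ + r) := by
    rw [ContinuousLinearMap.comp_sub, hA.1.add _ _ (by positivity) hs.1,
      hA.1.add _ _ (by positivity) hr.1]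
  have hjτ : j * τ + τ ≤ T := by linarith
  rw [e, le_div_iff₀ (by positivity)]
  have hjτ0 : 0 ≤ j * τ := by positivity
  rcases Nat.eq_zero_or_pos j with rfl | hj0
  · refine le_trans ?_ (le_max_right _ _)
    have h1 := hM (((0 : ℕ) : ℝ) * τ + s) ⟨by linarith [hs.1], by linarith [hs.2]⟩
    have h2 := hM (((0 : ℕ) : ℝ) * τ + r) ⟨by linarith [hr.1], by linarith [hr.2]⟩
    have h3 := norm_sub_le (S (((0 : ℕ) : ℝ) * τ + s)) (S (((0 : ℕ) : ℝ) * τ + r))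
    have h4 := le_abs_self M
    simp only [Nat.cast_zero, zero_add, mul_one] at *
    linarith
  · refine le_trans ?_ (le_max_left _ _)
    have hj1 : (1 : ℝ) ≤ j := by exact_mod_cast hj0
    have hjp : 0 < j * τ := by positivity
    have h1 := hC (j * τ + r) (j * τ + s) (by linarith [hr.1]) (by linarith)
      (by linarith [hs.2])
    have h2 : C / (j * τ + r) * (j * τ + s - (j * τ + r)) ≤ C / (j * τ) * τ := by
      have := hr.1
      gcongr
      · linarith
      · linarith
      · linarith [hs.2]
    have h3 : C / (j * τ) * τ = C / j := by field_simp
    calc _ ≤ C / j * (j + 1) := by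
          refine mul_le_mul_of_nonneg_right ?_ (by positivity)
          linarith
      _ = C * ((j + 1) / j) := by ring
      _ ≤ C * 2 := by
          refine mul_le_mul_of_nonneg_left ?_ hC0
          rw [div_le_iff₀ (by positivity)]; linarith
      _ = 2 * C := by ring

/-! ### Weighted means of operator families -/

theorem intervalIntegrable_smul {w : ℝ → ℝ} (hw : ContinuousOn w (Icc 0 1)) {f : ℝ → X}
    (hf : ContinuousOn f (Icc 0 1)) :
    IntervalIntegrable (fun θ => w θ • f θ) MeasureTheory.volume 0 1 :=
  (hw.smul hf).intervalIntegrable_of_Icc zero_le_one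

theorem norm_integral_smul_le {w : ℝ → ℝ} (hw1 : ∀ θ ∈ Icc (0 : ℝ) 1, |w θ| ≤ 1) {f : ℝ → X}
    {K : ℝ} (hf : ∀ θ ∈ Icc (0 : ℝ) 1, ‖f θ‖ ≤ K) : ‖∫ θ in (0 : ℝ)..1, w θ • f θ‖ ≤ K := by
  have := intervalIntegral.norm_integral_le_of_norm_le_const (a := (0 : ℝ)) (b := 1) (C := K)
    (f := fun θ => w θ • f θ) fun θ hθ => by
      rw [uIoc_of_le zero_le_one] at hθ
      have hθ' : θ ∈ Icc (0 : ℝ) 1 := Ioc_subset_Icc_self hθ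
      rw [norm_smul, Real.norm_eq_abs]
      exact (mul_le_mul (hw1 θ hθ') (hf θ hθ') (norm_nonneg _) zero_le_one).trans_eq (one_mul _)
  simpa using this

/-- The weighted mean `x ↦ ∫_0^1 w θ • F θ x dθ` of a strongly continuous family is a bounded
operator. -/
theorem exists_clm_eq_integral {F : ℝ → X →L[ℂ] X}
    (hF : ∀ x, ContinuousOn (fun θ => F θ x) (Icc 0 1)) {M : ℝ}
    (hM : ∀ θ ∈ Icc (0 : ℝ) 1, ‖F θ‖ ≤ M) {w : ℝ → ℝ} (hw : ContinuousOn w (Icc 0 1))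
    (hw1 : ∀ θ ∈ Icc (0 : ℝ) 1, |w θ| ≤ 1) :
    ∃ Φ : X →L[ℂ] X, ‖Φ‖ ≤ M ∧ ∀ x, Φ x = ∫ θ in (0 : ℝ)..1, w θ • F θ x := by
  have hM0 : 0 ≤ M := (norm_nonneg _).trans (hM 0 (by simp))
  let Φ : X →ₗ[ℂ] X :=
    { toFun := fun x => ∫ θ in (0 : ℝ)..1, w θ • F θ x
      map_add' := fun x y => by
        simp only [map_add, smul_add]
        exact intervalIntegral.integral_add (intervalIntegrable_smul hw (hF x))
          (intervalIntegrable_smul hw (hF y))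
      map_smul' := fun c x => by
        simp only [map_smul, RingHom.id_apply]
        rw [← intervalIntegral.integral_smul]
        simp only [smul_comm c] }
  exact ⟨Φ.mkContinuous M fun x => norm_integral_smul_le hw1 fun θ hθ =>
    (F θ).le_of_opNorm_le (hM θ hθ) x, Φ.mkContinuous_norm_le hM0 _, fun x => rfl⟩

/-- The "covariance" of two commuting operator families is controlled by products of increments:
`⟨F⟩⟨G⟩ - m⟨FG⟩ = -1/2 ∫∫ w(θ) w(σ) (F θ - F σ) (G θ - G σ)`, where `⟨F⟩ = ∫ w F` and `m = ∫ w`.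
The operator `L` is carried along since the increments get small only after smoothing. -/
theorem norm_covariance_le [CompleteSpace X] {F G : ℝ → X →L[ℂ] X}
    (hF : ∀ x, ContinuousOn (fun θ => F θ x) (Icc 0 1))
    (hG : ∀ x, ContinuousOn (fun θ => G θ x) (Icc 0 1))
    (hFG : ∀ θ ∈ Icc (0 : ℝ) 1, ∀ σ ∈ Icc (0 : ℝ) 1, ∀ x, F θ (G σ x) = G σ (F θ x))
    {w : ℝ → ℝ} (hw : ContinuousOn w (Icc 0 1)) (hw1 : ∀ θ ∈ Icc (0 : ℝ) 1, |w θ| ≤ 1)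
    (L : X →L[ℂ] X) (x : X) {K : ℝ}
    (hK : ∀ θ ∈ Icc (0 : ℝ) 1, ∀ σ ∈ Icc (0 : ℝ) 1, ‖L ((F θ - F σ) ((G θ - G σ) x))‖ ≤ K) :
    ‖L ((∫ θ in (0 : ℝ)..1, w θ • F θ (∫ σ in (0 : ℝ)..1, w σ • G σ x)) -
      (∫ θ in (0 : ℝ)..1, w θ) • ∫ θ in (0 : ℝ)..1, w θ • F θ (G θ x))‖ ≤ K := by
  obtain ⟨MF, hMF⟩ := exists_norm_le_of_isCompact isCompact_Icc hF
  obtain ⟨MG, hMG⟩ := exists_norm_le_of_isCompact isCompact_Icc hG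
  obtain ⟨ΦF, -, hΦF⟩ := exists_clm_eq_integral hF hMF hw hw1
  obtain ⟨ΦG, -, hΦG⟩ := exists_clm_eq_integral hG hMG hw hw1
  have hFGc : ContinuousOn (fun θ => F θ (G θ x)) (Icc 0 1) := continuousOn_clm_apply hMF hF (hG x)
  set m := ∫ θ in (0 : ℝ)..1, w θ with hm
  set H := ∫ θ in (0 : ℝ)..1, w θ • F θ (G θ x) with hH
  rw [← hΦG, ← hΦF]
  have hcomm1 : ∀ σ ∈ Icc (0 : ℝ) 1, ∀ y, ΦF (G σ y) = G σ (ΦF y) := by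
    intro σ hσ y
    rw [hΦF, hΦF, ← ContinuousLinearMap.intervalIntegral_comp_comm _
      (intervalIntegrable_smul hw (hF y))]
    refine intervalIntegral.integral_congr fun θ hθ => ?_
    rw [uIcc_of_le zero_le_one] at hθ
    simp only [ContinuousLinearMap.map_smul_of_tower, hFG θ hθ σ hσ]
  have hcomm : ΦF (ΦG x) = ΦG (ΦF x) := by
    rw [hΦG x, hΦG (ΦF x), ← ContinuousLinearMap.intervalIntegral_comp_comm _
      (intervalIntegrable_smul hw (hG x))]
    refine intervalIntegral.integral_congr fun θ hθ => ?_
    rw [uIcc_of_le zero_le_one] at hθ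
    simp only [ContinuousLinearMap.map_smul_of_tower, hcomm1 θ hθ]
  -- `I θ` is the inner integral of the double integral of the products of increments.
  let I : ℝ → X := fun θ => m • F θ (G θ x) - F θ (ΦG x) - G θ (ΦF x) + H
  have hIc : ContinuousOn I (Icc 0 1) :=
    (((hFGc.const_smul m).sub (hF _)).sub (hG _)).add continuousOn_const
  have hI : ∀ θ ∈ Icc (0 : ℝ) 1,
      I θ = ∫ σ in (0 : ℝ)..1, w σ • (F θ - F σ) ((G θ - G σ) x) := by
    intro θ hθ
    have h1 := intervalIntegrable_smul hw (continuousOn_const (c := F θ (G θ x)))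
    have h2 : IntervalIntegrable (fun σ => w σ • F θ (G σ x)) MeasureTheory.volume 0 1 :=
      intervalIntegrable_smul hw ((F θ).continuous.comp_continuousOn (hG x))
    have h3 : IntervalIntegrable (fun σ => w σ • G θ (F σ x)) MeasureTheory.volume 0 1 :=
      intervalIntegrable_smul hw ((G θ).continuous.comp_continuousOn (hF x))
    have h4 := intervalIntegrable_smul hw hFGc
    calc I θ = (∫ σ in (0 : ℝ)..1, w σ • F θ (G θ x)) - (∫ σ in (0 : ℝ)..1, w σ • F θ (G σ x))
          - (∫ σ in (0 : ℝ)..1, w σ • G θ (F σ x)) + ∫ σ in (0 : ℝ)..1, w σ • F σ (G σ x) := by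
          have e2 : (∫ σ in (0 : ℝ)..1, w σ • F θ (G σ x)) = F θ (ΦG x) := by
            rw [hΦG, ← ContinuousLinearMap.intervalIntegral_comp_comm _
              (intervalIntegrable_smul hw (hG x))]
            simp only [ContinuousLinearMap.map_smul_of_tower]
          have e3 : (∫ σ in (0 : ℝ)..1, w σ • G θ (F σ x)) = G θ (ΦF x) := by
            rw [hΦF, ← ContinuousLinearMap.intervalIntegral_comp_comm _
              (intervalIntegrable_smul hw (hF x))]
            simp only [ContinuousLinearMap.map_smul_of_tower]
          rw [intervalIntegral.integral_smul_const, e2, e3]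
      _ = ∫ σ in (0 : ℝ)..1, (w σ • F θ (G θ x) - w σ • F θ (G σ x) - w σ • G θ (F σ x)
            + w σ • F σ (G σ x)) := by
          rw [intervalIntegral.integral_add ((h1.sub h2).sub h3) h4,
            intervalIntegral.integral_sub (h1.sub h2) h3, intervalIntegral.integral_sub h1 h2]
      _ = _ := by
          refine intervalIntegral.integral_congr fun σ hσ => ?_
          rw [uIcc_of_le zero_le_one] at hσ
          simp only [sub_apply, map_sub, hFG σ hσ θ hθ, ← smul_sub, ← smul_add]
          congr 1
          abel
  have hIK : ∀ θ ∈ Icc (0 : ℝ) 1, ‖L (I θ)‖ ≤ K := by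
    intro θ hθ
    have hc : ContinuousOn (fun σ => (F θ - F σ) ((G θ - G σ) x)) (Icc 0 1) := by
      simp only [sub_apply, map_sub]
      exact (continuousOn_const.sub (hF (G θ x))).sub
        (((F θ).continuous.comp_continuousOn (hG x)).sub hFGc)
    rw [hI θ hθ, ← ContinuousLinearMap.intervalIntegral_comp_comm _ (intervalIntegrable_smul hw hc)]
    simp only [ContinuousLinearMap.map_smul_of_tower]
    exact norm_integral_smul_le hw1 fun σ hσ => hK θ hθ σ hσ
  have hout : (∫ θ in (0 : ℝ)..1, w θ • I θ) = -(2 : ℝ) • (ΦF (ΦG x) - m • H) := by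
    have h1 : IntervalIntegrable (fun θ => w θ • m • F θ (G θ x)) MeasureTheory.volume 0 1 :=
      intervalIntegrable_smul hw (hFGc.const_smul m)
    have h2 := intervalIntegrable_smul hw (hF (ΦG x))
    have h3 := intervalIntegrable_smul hw (hG (ΦF x))
    have h4 := intervalIntegrable_smul hw (continuousOn_const (c := H))
    simp only [I, smul_add, smul_sub]
    rw [intervalIntegral.integral_add ((h1.sub h2).sub h3) h4,
      intervalIntegral.integral_sub (h1.sub h2) h3, intervalIntegral.integral_sub h1 h2,
      ← hΦF, ← hΦG, intervalIntegral.integral_smul_const, ← hcomm]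
    simp only [smul_comm _ m]
    rw [intervalIntegral.integral_smul, ← hm, ← hH]
    module
  have hfin := norm_integral_smul_le hw1 hIK
  have hL : (∫ θ in (0 : ℝ)..1, w θ • L (I θ)) = -(2 : ℝ) • L (ΦF (ΦG x) - m • H) := by
    rw [← ContinuousLinearMap.map_smul_of_tower, ← hout,
      ← ContinuousLinearMap.intervalIntegral_comp_comm _ (intervalIntegrable_smul hw hIc)]
    simp only [ContinuousLinearMap.map_smul_of_tower]
  rw [hL, norm_smul, norm_neg, Real.norm_two] at hfin
  linarith [norm_nonneg (L (ΦF (ΦG x) - m • H))]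

/-! ### The exact solution -/

/-- Variation of constants. The vector `y t` stands for the generator of `P` applied to `u t`. -/
theorem IsC0Semigroup.variation_of_constants [CompleteSpace X] {P : ℝ → X →L[ℂ] X}
    (hP : IsC0Semigroup P) {T : ℝ} {u y f : ℝ → X}
    (hy : ∀ t ∈ Icc 0 T, Tendsto (fun h : ℝ => h⁻¹ • (P h (u t) - u t)) (𝓝[>] 0) (𝓝 (y t)))
    (hu : ∀ t ∈ Icc 0 T, HasDerivWithinAt u (y t + f t) (Icc 0 T) t)
    (hf : ContinuousOn f (Icc 0 T)) {t τ : ℝ} (ht : 0 ≤ t) (hτ : 0 ≤ τ) (htτ : t + τ ≤ T) :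
    u (t + τ) = P τ (u t) + τ • ∫ θ in (0 : ℝ)..1, P ((1 - θ) * τ) (f (t + θ * τ)) := by
  obtain ⟨M, hM⟩ := hP.exists_norm_le τ
  have hMs : ∀ s ∈ Icc 0 τ, ‖P (τ - s)‖ ≤ M := fun s hs =>
    hM _ ⟨sub_nonneg.2 hs.2, by linarith [hs.1]⟩
  have hPc : ∀ x, ContinuousOn (fun s => P (τ - s) x) (Icc 0 τ) := fun x =>
    (hP.cont x).comp (by fun_prop) fun s hs => sub_nonneg.2 hs.2
  have hmaps : MapsTo (fun s => t + s) (Icc 0 τ) (Icc 0 T) := fun s hs =>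
    ⟨by linarith [hs.1], by linarith [hs.2]⟩
  have huc : ContinuousOn u (Icc 0 T) := fun s hs => (hu s hs).continuousWithinAt
  have hint : ContinuousOn (fun s => P (τ - s) (f (t + s))) (Icc 0 τ) :=
    continuousOn_clm_apply hMs hPc (hf.comp (by fun_prop) hmaps)
  have hker : ContinuousOn (fun s => P (τ - s) (u (t + s))) (Icc 0 τ) :=
    continuousOn_clm_apply hMs hPc (huc.comp (by fun_prop) hmaps)
  have hftc := intervalIntegral.integral_eq_sub_of_hasDeriv_right (a := 0) (b := τ)
    (f := fun s => P (τ - s) (u (t + s))) (f' := fun s => P (τ - s) (f (t + s)))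
    (by rwa [uIcc_of_le hτ]) (fun s hs => by
      rw [min_eq_left hτ, max_eq_right hτ] at hs
      have hs' : t + s ∈ Icc 0 T := hmaps (Ioo_subset_Icc_self hs)
      have hnear : ∀ᶠ r in 𝓝[>] s, s < r ∧ r < τ :=
        (eventually_mem_nhdsWithin).and (nhdsWithin_le_nhds (Iio_mem_nhds hs.2))
      rw [hasDerivWithinAt_iff_tendsto_slope' self_notMem_Ioi]
      have l1 : Tendsto (fun r => (r - s)⁻¹ • (u (t + r) - u (t + s))) (𝓝[>] s)
          (𝓝 (y (t + s) + f (t + s))) := by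
        have h1 : HasDerivWithinAt u (y (t + s) + f (t + s)) (Ioi (t + s)) (t + s) :=
          (hu _ hs').mono_of_mem_nhdsWithin (by
            have hlt : t + s < T := by linarith [hs.2]
            exact mem_of_superset (Ioo_mem_nhdsGT hlt) fun r hr =>
              ⟨hs'.1.trans hr.1.le, hr.2.le⟩)
        rw [hasDerivWithinAt_iff_tendsto_slope' self_notMem_Ioi] at h1
        have h2 : Tendsto (fun r => t + r) (𝓝[>] s) (𝓝[>] (t + s)) := by
          refine tendsto_nhdsWithin_iff.2 ⟨?_, ?_⟩
          · exact ((continuous_const.add continuous_id).tendsto s).mono_left nhdsWithin_le_nhds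
          · filter_upwards [hnear] with r hr using by simpa using hr.1
        refine (h1.comp h2).congr fun r => ?_
        simp [slope_def_module]
      have l2 : Tendsto (fun r => (r - s)⁻¹ • (P (r - s) (u (t + s)) - u (t + s))) (𝓝[>] s)
          (𝓝 (y (t + s))) := by
        refine (hy _ hs').comp (tendsto_nhdsWithin_iff.2 ⟨?_, ?_⟩)
        · have : Tendsto (fun r : ℝ => r - s) (𝓝 s) (𝓝 (s - s)) :=
            (continuous_id.sub continuous_const).tendsto s
          rw [sub_self] at this
          exact this.mono_left nhdsWithin_le_nhds
        · filter_upwards [hnear] with r hr using sub_pos.2 hr.1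
      have l3 := l1.sub l2
      rw [add_sub_cancel_left] at l3
      have l4 : Tendsto (fun r => P (τ - r) (f (t + s))) (𝓝[>] s)
          (𝓝 (P (τ - s) (f (t + s)))) := by
        refine (hPc _ s (Ioo_subset_Icc_self hs)).tendsto.mono_left
          (nhdsWithin_le_of_mem (mem_of_superset (Ioo_mem_nhdsGT hs.2) fun r hr => ?_))
        exact ⟨hs.1.le.trans hr.1.le, hr.2.le⟩
      refine (tendsto_clm_apply (F := fun r => P (τ - r)) (M := M) ?_ l4 l3).congr' ?_
      · filter_upwards [hnear] with r hr using hMs r ⟨hs.1.le.trans hr.1.le, hr.2.le⟩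
      · -- Only right difference quotients of the semigroup are available: factor `P (τ - r)` out.
        filter_upwards [hnear] with r hr
        have e : P (τ - s) (u (t + s)) = P (τ - r) (P (r - s) (u (t + s))) := by
          rw [← hP.apply_add (by linarith [hr.2]) (by linarith [hr.1])]
          congr 2; ring
        simp only [slope_def_module, e, ← smul_sub, map_sub, ContinuousLinearMap.map_smul_of_tower]
        congr 1
        abel)
    (hint.intervalIntegrable_of_Icc hτ)
  have hsub := intervalIntegral.smul_integral_comp_mul_left (a := 0) (b := 1)
    (fun s => P (τ - s) (f (t + s))) τ
  rw [mul_zero, mul_one, hftc] at hsub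
  simp only [sub_self, hP.zero, sub_zero, add_zero, ContinuousLinearMap.id_apply] at hsub
  have e : (∫ θ in (0 : ℝ)..1, P ((1 - θ) * τ) (f (t + θ * τ)))
      = ∫ θ in (0 : ℝ)..1, P (τ - τ * θ) (f (t + τ * θ)) := by
    congr 1; ext θ; congr 2 <;> ring_nf
  rw [e, hsub]
  abel

/-- Linear interpolation error for a function with Lipschitz derivative. -/
theorem norm_sub_chord_le {f f' : ℝ → X} {T Λ : ℝ} (hΛ0 : 0 ≤ Λ)
    (hf : ∀ t ∈ Icc 0 T, HasDerivWithinAt f (f' t) (Icc 0 T) t)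
    (hΛ : ∀ s ∈ Icc 0 T, ∀ t ∈ Icc 0 T, ‖f' s - f' t‖ ≤ Λ * |s - t|) {t τ θ : ℝ} (ht : 0 ≤ t)
    (hτ : 0 ≤ τ) (htτ : t + τ ≤ T) (hθ : θ ∈ Icc (0 : ℝ) 1) :
    ‖f (t + θ * τ) - f t - θ • (f (t + τ) - f t)‖ ≤ 2 * Λ * τ ^ 2 := by
  have hsub : Icc t (t + τ) ⊆ Icc 0 T := Icc_subset_Icc ht htτ
  have key : ∀ θ ∈ Icc (0 : ℝ) 1, ‖f (t + θ * τ) - f t - (θ * τ) • f' t‖ ≤ Λ * τ ^ 2 := by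
    intro θ hθ
    have h0 : 0 ≤ θ * τ := mul_nonneg hθ.1 hτ
    have h1 : θ * τ ≤ τ := mul_le_of_le_one_left hτ hθ.2
    have := Convex.norm_image_sub_le_of_norm_hasDerivWithin_le (s := Icc t (t + τ))
      (f := fun s => f s - s • f' t) (f' := fun s => f' s - (1 : ℝ) • f' t) (C := Λ * τ)
      (x := t) (y := t + θ * τ)
      (fun s hs => ((hf s (hsub hs)).mono hsub).sub
        ((hasDerivWithinAt_id s _).smul_const (f' t)))
      (fun s hs => by
        rw [one_smul]
        refine (hΛ s (hsub hs) t ⟨ht, by linarith⟩).trans ?_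
        rw [abs_of_nonneg (by linarith [hs.1])]
        exact mul_le_mul_of_nonneg_left (by linarith [hs.2]) hΛ0)
      (convex_Icc _ _) ⟨le_rfl, by linarith⟩ ⟨by linarith, by linarith⟩
    rw [add_sub_cancel_left, Real.norm_of_nonneg h0] at this
    have e : f (t + θ * τ) - f t - (θ * τ) • f' t
        = f (t + θ * τ) - (t + θ * τ) • f' t - (f t - t • f' t) := by module
    rw [e]
    refine this.trans ?_
    nlinarith [mul_nonneg hΛ0 hτ]
  have h1 := key θ hθ
  have h2 := key 1 (by simp)
  rw [one_mul] at h2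
  have e : f (t + θ * τ) - f t - θ • (f (t + τ) - f t)
      = (f (t + θ * τ) - f t - (θ * τ) • f' t) - θ • (f (t + τ) - f t - τ • f' t) := by module
  rw [e]
  refine (norm_sub_le _ _).trans ?_
  rw [norm_smul, Real.norm_of_nonneg hθ.1]
  have h3 := mul_le_of_le_one_left (norm_nonneg (f (t + τ) - f t - τ • f' t)) hθ.2
  linarith

theorem exists_lipschitz_of_contDiffOn_Icc {u : ℝ → X} {T : ℝ} (hT : 0 < T)
    (hu : ContDiffOn ℝ 1 u (Icc 0 T)) :
    ∃ K : ℝ, 0 ≤ K ∧ (∀ t ∈ Icc 0 T, ‖derivWithin u (Icc 0 T) t‖ ≤ K) ∧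
      ∀ s ∈ Icc 0 T, ∀ t ∈ Icc 0 T, ‖u s - u t‖ ≤ K * |s - t| := by
  obtain ⟨K, hK⟩ := isCompact_Icc.exists_bound_of_continuousOn
    (hu.continuousOn_derivWithin (uniqueDiffOn_Icc hT) le_rfl)
  refine ⟨K, (norm_nonneg _).trans (hK 0 ⟨le_rfl, hT.le⟩), hK, fun s hs t ht => ?_⟩
  exact Convex.norm_image_sub_le_of_norm_derivWithin_le (hu.differentiableOn one_ne_zero) hK
    (convex_Icc _ _) ht hs

/-- Along a `C²` curve the nonlinearity is Lipschitz and has a Lipschitz derivative. -/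
theorem TwiceDiffBounded.comp_regularity {g : X → X} (hg : TwiceDiffBounded g) {u : ℝ → X} {T : ℝ}
    (hT : 0 < T) (hu : ContDiffOn ℝ 2 u (Icc 0 T)) :
    ∃ f' : ℝ → X, ∃ K : ℝ, 0 ≤ K ∧
      (∀ t ∈ Icc 0 T, HasDerivWithinAt (fun t => g (u t)) (f' t) (Icc 0 T) t) ∧
      (∀ s ∈ Icc 0 T, ∀ t ∈ Icc 0 T, ‖g (u s) - g (u t)‖ ≤ K * |s - t|) ∧
      ∀ s ∈ Icc 0 T, ∀ t ∈ Icc 0 T, ‖f' s - f' t‖ ≤ K * |s - t| := by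
  obtain ⟨hg1, hg2, ⟨K1, hK1⟩, ⟨K2, hK2⟩⟩ := hg
  have hK10 : 0 ≤ K1 := (norm_nonneg _).trans (hK1 0)
  have hK20 : 0 ≤ K2 := (norm_nonneg _).trans (hK2 0)
  have hL1 : ∀ x y, ‖g x - g y‖ ≤ K1 * ‖x - y‖ := fun x y =>
    Convex.norm_image_sub_le_of_norm_fderiv_le (fun z _ => hg1 z) (fun z _ => hK1 z) convex_univ
      (mem_univ y) (mem_univ x)
  have hL2 : ∀ x y, ‖fderiv ℝ g x - fderiv ℝ g y‖ ≤ K2 * ‖x - y‖ := fun x y =>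
    Convex.norm_image_sub_le_of_norm_fderiv_le (fun z _ => hg2 z) (fun z _ => hK2 z) convex_univ
      (mem_univ y) (mem_univ x)
  have hu' : ContDiffOn ℝ 1 (derivWithin u (Icc 0 T)) (Icc 0 T) :=
    ((contDiffOn_succ_iff_derivWithin (n := 1) (uniqueDiffOn_Icc hT)).1
      (by simpa [one_add_one_eq_two] using hu)).2.2
  obtain ⟨N1, hN10, hN1, hN1'⟩ := exists_lipschitz_of_contDiffOn_Icc hT (hu.of_le (by norm_num))
  obtain ⟨N2, hN20, -, hN2'⟩ := exists_lipschitz_of_contDiffOn_Icc hT hu'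
  refine ⟨fun t => fderiv ℝ g (u t) (derivWithin u (Icc 0 T) t),
    K1 * N1 + (K2 * N1 * N1 + K1 * N2), by positivity, fun t ht => ?_, fun s hs t ht => ?_,
    fun s hs t ht => ?_⟩
  · exact (hg1 (u t)).hasFDerivAt.comp_hasDerivWithinAt t
      ((hu.differentiableOn two_ne_zero) t ht).hasDerivWithinAt
  · have h1 := (hL1 (u s) (u t)).trans (mul_le_mul_of_nonneg_left (hN1' s hs t ht) hK10)
    have h2 : 0 ≤ (K2 * N1 * N1 + K1 * N2) * |s - t| := by positivity
    linarith
  · set a := derivWithin u (Icc 0 T) s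
    set b := derivWithin u (Icc 0 T) t
    have e : fderiv ℝ g (u s) a - fderiv ℝ g (u t) b
        = (fderiv ℝ g (u s) - fderiv ℝ g (u t)) a + fderiv ℝ g (u t) (a - b) := by
      simp [map_sub]
    have h1 : ‖(fderiv ℝ g (u s) - fderiv ℝ g (u t)) a‖ ≤ K2 * (N1 * |s - t|) * N1 :=
      (ContinuousLinearMap.le_opNorm _ _).trans (mul_le_mul ((hL2 _ _).trans
        (mul_le_mul_of_nonneg_left (hN1' s hs t ht) hK20)) (hN1 s hs) (norm_nonneg _)
        (by positivity))
    have h2 : ‖fderiv ℝ g (u t) (a - b)‖ ≤ K1 * (N2 * |s - t|) :=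
      (ContinuousLinearMap.le_of_opNorm_le _ (hK1 _) _).trans
        (mul_le_mul_of_nonneg_left (hN2' s hs t ht) hK10)
    have h3 : 0 ≤ K1 * N1 * |s - t| := by positivity
    show ‖fderiv ℝ g (u s) a - fderiv ℝ g (u t) b‖ ≤ _
    rw [e]
    refine (norm_add_le _ _).trans ?_
    linarith

/-! ### The splitting defect of the `φ`-functions -/

/-- `splitDefect SA SB l τ = (l + 1)! φ_{l+1}(τA) φ_{l+1}(τB) - φ_{l+1}(τ(A + B))`, where
`exp (t (A + B))` is expressed as `SA t ∘ SB t`. -/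
noncomputable def splitDefect (SA SB : ℝ → X →L[ℂ] X) (l : ℕ) (τ : ℝ) (x : X) : X :=
  ((l + 1).factorial : ℝ) • phi SA (l + 1) τ (phi SB (l + 1) τ x) -
    phi (fun t => (SA t).comp (SB t)) (l + 1) τ x

theorem IsC0Semigroup.continuousOn_reflect {S : ℝ → X →L[ℂ] X} (hS : IsC0Semigroup S) {τ : ℝ}
    (hτ : 0 ≤ τ) (x : X) : ContinuousOn (fun θ : ℝ => S ((1 - θ) * τ) x) (Icc 0 1) :=
  (hS.cont x).comp (by fun_prop) fun _ hθ => mul_nonneg (sub_nonneg.2 hθ.2) hτ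

theorem one_sub_mul_mem_Icc {τ θ : ℝ} (hτ : 0 ≤ τ) (hθ : θ ∈ Icc (0 : ℝ) 1) :
    (1 - θ) * τ ∈ Icc 0 τ :=
  ⟨mul_nonneg (sub_nonneg.2 hθ.2) hτ, mul_le_of_le_one_left hτ (by linarith [hθ.1])⟩

theorem abs_pow_le_one_of_mem_Icc (l : ℕ) : ∀ θ ∈ Icc (0 : ℝ) 1, |θ ^ l| ≤ 1 := fun θ hθ => by
  rw [abs_of_nonneg (pow_nonneg hθ.1 l)]
  exact pow_le_one₀ hθ.1 hθ.2

theorem IsC0Semigroup.exists_clm_eq_phi {S : ℝ → X →L[ℂ] X} (hS : IsC0Semigroup S) {τ M : ℝ}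
    (hτ : 0 ≤ τ) (hM : ∀ t ∈ Icc 0 τ, ‖S t‖ ≤ M) (l : ℕ) :
    ∃ Φ : X →L[ℂ] X, ‖Φ‖ ≤ M ∧ ∀ x, phi S (l + 1) τ x = Φ x := by
  obtain ⟨Φ, hΦ, hΦx⟩ := exists_clm_eq_integral (F := fun θ => S ((1 - θ) * τ)) (M := M)
    (hS.continuousOn_reflect hτ) (fun θ hθ => hM _ (one_sub_mul_mem_Icc hτ hθ))
    (w := fun θ => θ ^ l) (by fun_prop) (abs_pow_le_one_of_mem_Icc l)
  refine ⟨((l.factorial : ℝ)⁻¹) • Φ, ?_, fun x => ?_⟩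
  · have h1 : (1 : ℝ) ≤ l.factorial := by exact_mod_cast l.factorial_pos
    rw [norm_smul, Real.norm_of_nonneg (by positivity)]
    exact (mul_le_of_le_one_left (norm_nonneg _) (inv_le_one_of_one_le₀ h1)).trans hΦ
  · rw [smul_apply, hΦx]; rfl

theorem norm_splitDefect_le [CompleteSpace X] {SA SB : ℝ → X →L[ℂ] X} (hA : IsC0Semigroup SA)
    (hB : IsC0Semigroup SB)
    (hcomm : ∀ t : ℝ, 0 ≤ t → (SA t).comp (SB t) = (SB t).comp (SA t))
    (l : ℕ) {τ : ℝ} (hτ : 0 ≤ τ) (L : X →L[ℂ] X) (x : X) {K : ℝ}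
    (hK : ∀ s ∈ Icc 0 τ, ∀ r ∈ Icc 0 τ, ‖L ((SA s - SA r) ((SB s - SB r) x))‖ ≤ K) :
    ‖L (splitDefect SA SB l τ x)‖ ≤ 2 * K := by
  have hcov := norm_covariance_le (hA.continuousOn_reflect hτ) (hB.continuousOn_reflect hτ)
    (fun θ hθ σ hσ y => hA.commute hB hcomm (one_sub_mul_mem_Icc hτ hθ).1
      (one_sub_mul_mem_Icc hτ hσ).1 y)
    (w := fun θ => θ ^ l) (by fun_prop) (abs_pow_le_one_of_mem_Icc l) L x
    (fun θ hθ σ hσ => hK _ (one_sub_mul_mem_Icc hτ hθ) _ (one_sub_mul_mem_Icc hτ hσ))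
  have hK0 : 0 ≤ K := (norm_nonneg _).trans (hK 0 ⟨le_rfl, hτ⟩ 0 ⟨le_rfl, hτ⟩)
  have hl : (0 : ℝ) < l.factorial := by exact_mod_cast l.factorial_pos
  have hm : (∫ θ in (0 : ℝ)..1, θ ^ l) = ((l : ℝ) + 1)⁻¹ := by
    rw [integral_pow]; simp
  rw [hm] at hcov
  have e : splitDefect SA SB l τ x = (((l : ℝ) + 1) / l.factorial) •
      ((∫ θ in (0 : ℝ)..1, θ ^ l • SA ((1 - θ) * τ)
        (∫ σ in (0 : ℝ)..1, σ ^ l • SB ((1 - σ) * τ) x)) -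
        ((l : ℝ) + 1)⁻¹ • ∫ θ in (0 : ℝ)..1, θ ^ l • SA ((1 - θ) * τ) (SB ((1 - θ) * τ) x)) := by
    have e1 : phi SA (l + 1) τ (phi SB (l + 1) τ x) =
        ((l.factorial : ℝ)⁻¹ * (l.factorial : ℝ)⁻¹) • ∫ θ in (0 : ℝ)..1, θ ^ l •
          SA ((1 - θ) * τ) (∫ σ in (0 : ℝ)..1, σ ^ l • SB ((1 - σ) * τ) x) := by
      simp only [phi, ContinuousLinearMap.map_smul_of_tower]
      rw [mul_smul]
      congr 1
      rw [← intervalIntegral.integral_smul]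
      exact intervalIntegral.integral_congr fun θ _ => smul_comm _ _ _
    rw [splitDefect, e1]
    simp only [phi, ContinuousLinearMap.comp_apply, smul_sub, smul_smul, Nat.factorial_succ]
    push_cast
    congr 2 <;> field_simp
  have hle : ((l : ℝ) + 1) / l.factorial ≤ 2 := by
    rw [div_le_iff₀ hl]
    have : l + 1 ≤ 2 * l.factorial := by
      rcases Nat.eq_zero_or_pos l with rfl | h
      · simp
      · have := l.self_le_factorial
        omega
    exact_mod_cast this
  rw [e, ContinuousLinearMap.map_smul_of_tower, norm_smul, Real.norm_of_nonneg (by positivity)]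
  exact mul_le_mul hle hcov (norm_nonneg _) zero_le_two

/-! ### The local error -/

/-- On `D(A) ∩ D(B)` the generator of `SA t ∘ SB t` is `A + B`. -/
theorem tendsto_comp_generator [CompleteSpace X] {SA SB : ℝ → X →L[ℂ] X} (hA : IsC0Semigroup SA)
    {x y z : X} (hy : Tendsto (fun t : ℝ => t⁻¹ • (SA t x - x)) (𝓝[>] 0) (𝓝 y))
    (hz : Tendsto (fun t : ℝ => t⁻¹ • (SB t x - x)) (𝓝[>] 0) (𝓝 z)) :
    Tendsto (fun t : ℝ => t⁻¹ • ((SA t).comp (SB t) x - x)) (𝓝[>] 0) (𝓝 (y + z)) := by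
  obtain ⟨M, hM⟩ := hA.exists_norm_le 1
  have h1 : Tendsto (fun t => SA t z) (𝓝[>] 0) (𝓝 z) := by
    have := (hA.cont z 0 self_mem_Ici).tendsto.mono_left (nhdsWithin_mono 0 Ioi_subset_Ici_self)
    simpa [hA.zero] using this
  have h2 := tendsto_clm_apply (F := SA) (M := M) (by
    filter_upwards [Ioo_mem_nhdsGT zero_lt_one] with t ht using hM t ⟨ht.1.le, ht.2.le⟩) h1 hz
  refine (hy.add h2).congr fun t => ?_
  rw [ContinuousLinearMap.map_smul_of_tower, ← smul_add, map_sub, ContinuousLinearMap.comp_apply]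
  congr 1
  abel

theorem phi_comp_one_add_two {P : ℝ → X →L[ℂ] X} (hP : IsC0Semigroup P) {τ : ℝ} (hτ : 0 ≤ τ)
    (x d : X) : phi P 1 τ x + phi P 2 τ d =
      ∫ θ in (0 : ℝ)..1, P ((1 - θ) * τ) (x + θ • d) := by
  have h1 : IntervalIntegrable (fun θ : ℝ => P ((1 - θ) * τ) x) MeasureTheory.volume 0 1 :=
    (hP.continuousOn_reflect hτ x).intervalIntegrable_of_Icc zero_le_one
  have h2 : IntervalIntegrable (fun θ : ℝ => θ • P ((1 - θ) * τ) d) MeasureTheory.volume 0 1 :=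
    intervalIntegrable_smul (w := fun θ => θ) (by fun_prop) (hP.continuousOn_reflect hτ d)
  simp only [phi, map_add, ContinuousLinearMap.map_smul_of_tower]
  rw [intervalIntegral.integral_add h1 h2]
  simp

/-- Replacing the forcing term `h θ` of the variation-of-constants integral by the affine function
`x + θ • d` turns it into `φ_1 x + φ_2 d` and costs the supremum of the difference. -/
theorem norm_integral_sub_phi_le [CompleteSpace X] {P : ℝ → X →L[ℂ] X} (hP : IsC0Semigroup P)
    {τ M K : ℝ} (hτ : 0 ≤ τ) (hM : ∀ t ∈ Icc 0 τ, ‖P t‖ ≤ M) {h : ℝ → X}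
    (hh : ContinuousOn h (Icc 0 1)) (x d : X)
    (hK : ∀ θ ∈ Icc (0 : ℝ) 1, ‖h θ - x - θ • d‖ ≤ K) :
    ‖(∫ θ in (0 : ℝ)..1, P ((1 - θ) * τ) (h θ)) - (phi P 1 τ x + phi P 2 τ d)‖ ≤ M * K := by
  have hPM : ∀ θ ∈ Icc (0 : ℝ) 1, ‖P ((1 - θ) * τ)‖ ≤ M := fun θ hθ =>
    hM _ (one_sub_mul_mem_Icc hτ hθ)
  have hM0 : 0 ≤ M := (norm_nonneg _).trans (hPM 0 (by simp))
  have hc : ∀ {v : ℝ → X}, ContinuousOn v (Icc 0 1) →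
      IntervalIntegrable (fun θ => P ((1 - θ) * τ) (v θ)) MeasureTheory.volume 0 1 := fun hv =>
    (continuousOn_clm_apply hPM (hP.continuousOn_reflect hτ) hv).intervalIntegrable_of_Icc
      zero_le_one
  rw [phi_comp_one_add_two hP hτ, ← intervalIntegral.integral_sub (hc hh)
    (hc (by fun_prop : ContinuousOn (fun θ : ℝ => x + θ • d) (Icc 0 1)))]
  have := norm_integral_smul_le (w := fun _ => 1) (by simp)
    (f := fun θ => P ((1 - θ) * τ) (h θ) - P ((1 - θ) * τ) (x + θ • d)) (K := M * K)
    fun θ hθ => by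
      rw [← map_sub, ← sub_sub]
      exact ((P _).le_opNorm _).trans
        (mul_le_mul (hPM θ hθ) (hK θ hθ) (norm_nonneg _) hM0)
  simpa using this

/-- The local error of the scheme is `τ` times the splitting defects of `φ_1` and `φ_2`, up to
a remainder which is of third order as soon as the defect of `φ_1` is of first order. -/
theorem exists_norm_local_error_le [CompleteSpace X] {SA SB : ℝ → X →L[ℂ] X}
    (hA : IsC0Semigroup SA) (hB : IsC0Semigroup SB)
    (hcomm : ∀ t : ℝ, 0 ≤ t → (SA t).comp (SB t) = (SB t).comp (SA t))
    {g : X → X} (hg : TwiceDiffBounded g) {T : ℝ} (hT : 0 < T) {u y : ℝ → X}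
    (hy : ∀ t ∈ Icc 0 T,
      Tendsto (fun h : ℝ => h⁻¹ • ((SA h).comp (SB h) (u t) - u t)) (𝓝[>] 0) (𝓝 (y t)))
    (hu : ∀ t ∈ Icc 0 T, HasDerivWithinAt u (y t + g (u t)) (Icc 0 T) t)
    (hu2 : ContDiffOn ℝ 2 u (Icc 0 T)) :
    ∃ C : ℝ, 0 ≤ C ∧ ∀ t τ : ℝ, 0 ≤ t → 0 < τ → t + τ ≤ T →
      ‖step SA SB g τ (u t) - u (t + τ) - τ • splitDefect SA SB 0 τ (g (u t)) -
        τ • splitDefect SA SB 1 τ (g (u (t + τ)) - g (u t))‖ ≤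
      C * τ ^ 2 * (‖splitDefect SA SB 0 τ (g (u t))‖ + τ) := by
  have hP := hA.comp hB hcomm
  obtain ⟨MA, hMA⟩ := hA.exists_norm_le T
  obtain ⟨MB, hMB⟩ := hB.exists_norm_le T
  obtain ⟨MP, hMP⟩ := hP.exists_norm_le T
  have h0T : (0 : ℝ) ∈ Icc 0 T := ⟨le_rfl, hT.le⟩
  have hMA0 : 0 ≤ MA := (norm_nonneg _).trans (hMA 0 h0T)
  have hMB0 : 0 ≤ MB := (norm_nonneg _).trans (hMB 0 h0T)
  have hMP0 : 0 ≤ MP := (norm_nonneg _).trans (hMP 0 h0T)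
  obtain ⟨f', Λ, hΛ0, hf', hfL, hf'L⟩ := hg.comp_regularity hT hu2
  obtain ⟨hg1, -, ⟨K, hK⟩, -⟩ := hg
  have hK0 : 0 ≤ K := (norm_nonneg _).trans (hK 0)
  have hgL : ∀ x y, ‖g x - g y‖ ≤ K * ‖x - y‖ := fun x y =>
    Convex.norm_image_sub_le_of_norm_fderiv_le (fun z _ => hg1 z) (fun z _ => hK z) convex_univ
      (mem_univ y) (mem_univ x)
  have hfc : ContinuousOn (fun t => g (u t)) (Icc 0 T) := fun t ht =>
    (hf' t ht).continuousWithinAt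
  set c := 2 * (MA * MB) * K with hcdef
  have hc0 : 0 ≤ c := by positivity
  refine ⟨c + c * MP * Λ + MP * (2 * Λ), by positivity, fun t τ ht hτ htτ => ?_⟩
  have hsub : ∀ s ∈ Icc 0 τ, s ∈ Icc 0 T := fun s hs => ⟨hs.1, by linarith [hs.2]⟩
  have htT : t ∈ Icc 0 T := ⟨ht, by linarith⟩
  have htτT : t + τ ∈ Icc 0 T := ⟨by linarith, htτ⟩
  have hPτ : ∀ s ∈ Icc 0 τ, ‖(SA s).comp (SB s)‖ ≤ MP := fun s hs => hMP s (hsub s hs)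
  have hmaps : MapsTo (fun θ : ℝ => t + θ * τ) (Icc 0 1) (Icc 0 T) := fun θ hθ =>
    ⟨by have := mul_nonneg hθ.1 hτ.le; linarith,
      by have := mul_le_of_le_one_left hτ.le hθ.2; linarith⟩
  have hvoc := hP.variation_of_constants hy hu hfc ht hτ.le htτ
  simp only [ContinuousLinearMap.comp_apply] at hvoc
  obtain ⟨ΦA, hΦA, hΦAx⟩ := hA.exists_clm_eq_phi hτ.le (fun s hs => hMA s (hsub s hs)) 1
  obtain ⟨ΦB, hΦB, hΦBx⟩ := hB.exists_clm_eq_phi hτ.le (fun s hs => hMB s (hsub s hs)) 1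
  have hhc : ContinuousOn (fun θ : ℝ => g (u (t + θ * τ))) (Icc 0 1) :=
    hfc.comp (by fun_prop) hmaps
  set D := splitDefect SA SB 0 τ (g (u t)) with hD
  set d := g (u (t + τ)) - g (u t) with hd
  set I := ∫ θ in (0 : ℝ)..1, SA ((1 - θ) * τ) (SB ((1 - θ) * τ) (g (u (t + θ * τ)))) with hI
  set P : ℝ → X →L[ℂ] X := fun s => (SA s).comp (SB s) with hPdef
  -- Freezing the nonlinearity costs one order, interpolating it linearly costs two.
  have hρ1 : ‖I - (phi P 1 τ (g (u t)) + phi P 2 τ 0)‖ ≤ MP * (Λ * τ) := by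
    refine norm_integral_sub_phi_le hP hτ.le hPτ hhc _ _ fun θ hθ => ?_
    rw [smul_zero, sub_zero]
    refine (hfL _ (hmaps hθ) _ htT).trans (mul_le_mul_of_nonneg_left ?_ hΛ0)
    rw [add_sub_cancel_left, abs_of_nonneg (mul_nonneg hθ.1 hτ.le)]
    exact mul_le_of_le_one_left hτ.le hθ.2
  have hρ2 : ‖I - (phi P 1 τ (g (u t)) + phi P 2 τ d)‖ ≤ MP * (2 * Λ * τ ^ 2) :=
    norm_integral_sub_phi_le hP hτ.le hPτ hhc _ _ fun θ hθ =>
      norm_sub_chord_le hΛ0 hf' hf'L ht hτ.le htτ hθ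
  have hφ0 : phi P 2 τ 0 = 0 := by simp [phi]
  rw [hφ0, add_zero] at hρ1
  have hD0 : phi SA 1 τ (phi SB 1 τ (g (u t))) = D + phi P 1 τ (g (u t)) := by
    simp [hD, splitDefect, hPdef]
  set U := stage SA SB g τ (u t) with hU
  have hUe : U - u (t + τ) = τ • D - τ • (I - phi P 1 τ (g (u t))) := by
    rw [hU, stage, hvoc, hD0]
    module
  have hUn : ‖U - u (t + τ)‖ ≤ τ * ‖D‖ + τ * (MP * (Λ * τ)) := by
    rw [hUe]
    refine (norm_sub_le _ _).trans ?_
    rw [norm_smul, norm_smul, Real.norm_of_nonneg hτ.le]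
    gcongr
  have hD1 : (2 : ℝ) • ΦA (ΦB d) = splitDefect SA SB 1 τ d + phi P 2 τ d := by
    simp [splitDefect, hPdef, hΦAx, hΦBx]
  have hstep : step SA SB g τ (u t) - u (t + τ) - τ • D - τ • splitDefect SA SB 1 τ d =
      (2 * τ) • ΦA (ΦB (g U - g (u (t + τ)))) - τ • (I - (phi P 1 τ (g (u t)) + phi P 2 τ d)) := by
    have e1 : g U - g (u t) = (g U - g (u (t + τ))) + d := by rw [hd]; abel
    have e2 : step SA SB g τ (u t) = U + (2 * τ) • ΦA (ΦB (g U - g (u t))) := by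
      rw [step, ← hU, hΦBx, hΦAx]
    have e3 : splitDefect SA SB 1 τ d = (2 : ℝ) • ΦA (ΦB d) - phi P 2 τ d := by
      rw [hD1, add_sub_cancel_right]
    rw [e2, e1, map_add, map_add, e3, sub_eq_iff_eq_add.1 hUe]
    module
  rw [hstep]
  have hn1 : ‖ΦA (ΦB (g U - g (u (t + τ))))‖ ≤ MA * (MB * (K * ‖U - u (t + τ)‖)) :=
    ΦA.le_of_opNorm_le_of_le hΦA (ΦB.le_of_opNorm_le_of_le hΦB (hgL _ _))
  calc _ ≤ ‖(2 * τ) • ΦA (ΦB (g U - g (u (t + τ))))‖ +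
        ‖τ • (I - (phi P 1 τ (g (u t)) + phi P 2 τ d))‖ := norm_sub_le _ _
    _ ≤ 2 * τ * (MA * (MB * (K * (τ * ‖D‖ + τ * (MP * (Λ * τ)))))) +
        τ * (MP * (2 * Λ * τ ^ 2)) := by
        rw [norm_smul, norm_smul, Real.norm_of_nonneg hτ.le,
          Real.norm_of_nonneg (by positivity : 0 ≤ 2 * τ)]
        gcongr
        exact hn1.trans (by gcongr)
    _ = c * τ ^ 2 * ‖D‖ + (c * MP * Λ + MP * (2 * Λ)) * τ ^ 2 * τ := by rw [hcdef]; ring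
    _ ≤ _ := by
        have h1 : 0 ≤ (c * MP * Λ + MP * (2 * Λ)) * τ ^ 2 * ‖D‖ := by positivity
        have h2 : 0 ≤ c * τ ^ 2 * τ := by positivity
        linarith

/-! ### Stability and error propagation -/

/-- One step of the scheme differs from the linear propagator by a map with Lipschitz constant
`O(τ)`. -/
theorem exists_norm_step_sub_le [CompleteSpace X] {SA SB : ℝ → X →L[ℂ] X}
    (hA : IsC0Semigroup SA) (hB : IsC0Semigroup SB) {g : X → X} {K : ℝ}
    (hg : ∀ x y, ‖g x - g y‖ ≤ K * ‖x - y‖) (hK : 0 ≤ K) {T : ℝ} (hT : 0 < T) :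
    ∃ Λ : ℝ, 0 ≤ Λ ∧ ∀ τ : ℝ, 0 < τ → τ ≤ T → ∀ v w : X,
      ‖step SA SB g τ v - step SA SB g τ w - (SA τ).comp (SB τ) (v - w)‖ ≤ Λ * τ * ‖v - w‖ := by
  obtain ⟨MA, hMA⟩ := hA.exists_norm_le T
  obtain ⟨MB, hMB⟩ := hB.exists_norm_le T
  have h0T : (0 : ℝ) ∈ Icc 0 T := ⟨le_rfl, hT.le⟩
  have hMA0 : 0 ≤ MA := (norm_nonneg _).trans (hMA 0 h0T)
  have hMB0 : 0 ≤ MB := (norm_nonneg _).trans (hMB 0 h0T)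
  set m := MA * MB with hm
  have hm0 : 0 ≤ m := mul_nonneg hMA0 hMB0
  refine ⟨m * K + 2 * (m * (K * (m + T * (m * K)) + K)), by positivity, fun τ hτ hτT v w => ?_⟩
  have hsub : ∀ s ∈ Icc 0 τ, s ∈ Icc 0 T := fun s hs => ⟨hs.1, hs.2.trans hτT⟩
  have hτm : τ ∈ Icc 0 T := ⟨hτ.le, hτT⟩
  obtain ⟨Φ1, hΦ1, hΦ1x⟩ := hA.exists_clm_eq_phi hτ.le (fun s hs => hMA s (hsub s hs)) 0
  obtain ⟨Ψ1, hΨ1, hΨ1x⟩ := hB.exists_clm_eq_phi hτ.le (fun s hs => hMB s (hsub s hs)) 0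
  obtain ⟨Φ2, hΦ2, hΦ2x⟩ := hA.exists_clm_eq_phi hτ.le (fun s hs => hMA s (hsub s hs)) 1
  obtain ⟨Ψ2, hΨ2, hΨ2x⟩ := hB.exists_clm_eq_phi hτ.le (fun s hs => hMB s (hsub s hs)) 1
  have hcomp : ∀ {Φ Ψ : X →L[ℂ] X}, ‖Φ‖ ≤ MA → ‖Ψ‖ ≤ MB → ∀ x, ‖Φ (Ψ x)‖ ≤ m * ‖x‖ :=
    fun {Φ Ψ} hΦ hΨ x => by
      rw [hm, mul_assoc]
      exact Φ.le_of_opNorm_le_of_le hΦ (Ψ.le_of_opNorm_le hΨ x)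
  set V := stage SA SB g τ v with hV
  set W := stage SA SB g τ w with hW
  have hstage : V - W = SA τ (SB τ (v - w)) + τ • Φ1 (Ψ1 (g v - g w)) := by
    simp only [hV, hW, stage, hΦ1x, hΨ1x, map_sub]
    module
  have hΦΨ1 : ‖Φ1 (Ψ1 (g v - g w))‖ ≤ m * (K * ‖v - w‖) :=
    (hcomp hΦ1 hΨ1 _).trans (mul_le_mul_of_nonneg_left (hg v w) hm0)
  have hVW : ‖V - W‖ ≤ (m + T * (m * K)) * ‖v - w‖ := by
    rw [hstage]
    refine (norm_add_le _ _).trans ?_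
    rw [norm_smul, Real.norm_of_nonneg hτ.le]
    have h1 := hcomp (hMA τ hτm) (hMB τ hτm) (v - w)
    have h2 : τ * ‖Φ1 (Ψ1 (g v - g w))‖ ≤ T * (m * (K * ‖v - w‖)) := by gcongr
    linarith
  have hΦΨ2 : ‖Φ2 (Ψ2 ((g V - g W) - (g v - g w)))‖ ≤
      m * (K * ((m + T * (m * K)) * ‖v - w‖) + K * ‖v - w‖) := by
    refine (hcomp hΦ2 hΨ2 _).trans (mul_le_mul_of_nonneg_left ?_ hm0)
    refine (norm_sub_le _ _).trans (add_le_add ((hg V W).trans ?_) (hg v w))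
    gcongr
  have e : step SA SB g τ v - step SA SB g τ w - (SA τ).comp (SB τ) (v - w) =
      τ • Φ1 (Ψ1 (g v - g w)) + (2 * τ) • Φ2 (Ψ2 ((g V - g W) - (g v - g w))) := by
    have e1 : step SA SB g τ v - step SA SB g τ w =
        (V - W) + (2 * τ) • Φ2 (Ψ2 ((g V - g W) - (g v - g w))) := by
      simp only [step, ← hV, ← hW, hΦ2x, hΨ2x, map_sub]
      module
    rw [e1, hstage, ContinuousLinearMap.comp_apply]
    abel
  rw [e]
  calc _ ≤ τ * (m * (K * ‖v - w‖)) +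
        2 * τ * (m * (K * ((m + T * (m * K)) * ‖v - w‖) + K * ‖v - w‖)) := by
        refine (norm_add_le _ _).trans ?_
        rw [norm_smul, norm_smul, Real.norm_of_nonneg hτ.le,
          Real.norm_of_nonneg (by positivity : 0 ≤ 2 * τ)]
        gcongr
    _ = _ := by ring

/-- Discrete Gronwall inequality in summed form. -/
theorem le_mul_pow_of_le_add_sum {a : ℕ → ℝ} {D q : ℝ} (hq : 0 ≤ q) {N : ℕ}
    (h : ∀ n ≤ N, a n ≤ D + q * ∑ k ∈ Finset.range n, a k) :
    ∀ n ≤ N, a n ≤ D * (1 + q) ^ n := by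
  intro n
  induction n using Nat.strong_induction_on with
  | _ n ih =>
    intro hn
    have h1 : ∑ k ∈ Finset.range n, a k ≤ ∑ k ∈ Finset.range n, D * (1 + q) ^ k :=
      Finset.sum_le_sum fun k hk =>
        ih k (Finset.mem_range.1 hk) ((Finset.mem_range.1 hk).le.trans hn)
    have h2 := geom_sum_mul (1 + q) n
    rw [add_sub_cancel_left] at h2
    calc a n ≤ D + q * ∑ k ∈ Finset.range n, a k := h n hn
      _ ≤ D + q * ∑ k ∈ Finset.range n, D * (1 + q) ^ k := by gcongr
      _ = D + D * ((∑ k ∈ Finset.range n, (1 + q) ^ k) * q) := by rw [← Finset.mul_sum]; ring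
      _ = D * (1 + q) ^ n := by rw [h2]; ring

/-- Error propagation: the error recursion with propagator `p`, Lipschitz perturbations `r k` and
local errors `δ k`, the latter being measured after `j` applications of `p`. -/
theorem norm_le_of_error_recursion {p : X →L[ℂ] X} {e r δ : ℕ → X} {γ : ℕ → ℝ} {M q : ℝ} {N : ℕ}
    (hM0 : 0 ≤ M) (hq : 0 ≤ q) (h0 : e 0 = 0)
    (hrec : ∀ k < N, e (k + 1) = p (e k) + (r k + δ k)) (hp : ∀ j < N, ‖p ^ j‖ ≤ M)
    (hr : ∀ k < N, ‖r k‖ ≤ q * ‖e k‖) (hδ : ∀ j < N, ∀ k < N, ‖(p ^ j) (δ k)‖ ≤ γ j) :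
    ‖e N‖ ≤ (∑ j ∈ Finset.range N, γ j) * Real.exp (N * (M * q)) := by
  have hsol : ∀ n ≤ N, e n = ∑ k ∈ Finset.range n, (p ^ (n - 1 - k)) (r k + δ k) := by
    intro n hn
    induction n with
    | zero => simp [h0]
    | succ n ih =>
      rw [hrec n hn, ih (Nat.le_of_succ_le hn), map_sum, Finset.sum_range_succ]
      congr 1
      · refine Finset.sum_congr rfl fun k hk => ?_
        have : n + 1 - 1 - k = (n - 1 - k) + 1 := by have := Finset.mem_range.1 hk; omega
        rw [this, pow_succ']
        rfl
      · simp
  have hγ0 : ∀ j < N, 0 ≤ γ j := fun j hj => (norm_nonneg _).trans (hδ j hj j hj)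
  have hgr := le_mul_pow_of_le_add_sum (a := fun n => ‖e n‖) (D := ∑ j ∈ Finset.range N, γ j)
    (q := M * q) (by positivity) (N := N) (fun n hn => by
      rw [hsol n hn]
      calc _ ≤ ∑ k ∈ Finset.range n, (M * q * ‖e k‖ + γ (n - 1 - k)) := by
            refine norm_sum_le_of_le _ fun k hk => ?_
            have hk' := Finset.mem_range.1 hk
            rw [map_add]
            refine (norm_add_le _ _).trans (add_le_add ?_ (hδ _ (by omega) _ (by omega)))
            rw [mul_assoc]
            exact (p ^ (n - 1 - k)).le_of_opNorm_le_of_le (hp _ (by omega)) (hr k (by omega))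
        _ = M * q * ∑ k ∈ Finset.range n, ‖e k‖ + ∑ j ∈ Finset.range n, γ j := by
            rw [Finset.sum_add_distrib, Finset.mul_sum, Finset.sum_range_reflect]
        _ ≤ _ := by
            rw [add_comm]
            gcongr
            exact fun j hj _ => hγ0 j (Finset.mem_range.1 hj))
  refine (hgr N le_rfl).trans (mul_le_mul_of_nonneg_left ?_
    (Finset.sum_nonneg fun j hj => hγ0 j (Finset.mem_range.1 hj)))
  rw [Real.exp_nat_mul]
  refine pow_le_pow_left₀ (by positivity) ?_ _
  rw [add_comm]
  exact Real.add_one_le_exp _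

theorem sum_range_inv_sq_le (n : ℕ) : ∑ j ∈ Finset.range n, 1 / ((j : ℝ) + 1) ^ 2 ≤ 2 := by
  have h := sum_Ioo_inv_sq_le (α := ℝ) 0 (n + 1)
  have e : Finset.Ioo 0 (n + 1) = Finset.Ico (0 + 1) (n + 1) := by ext; simp; omega
  rw [e, ← Finset.sum_Ico_add' (fun i : ℕ => ((i : ℝ) ^ 2)⁻¹), ← Finset.range_eq_Ico] at h
  simpa [one_div] using h

theorem sum_range_inv_le (n : ℕ) : ∑ j ∈ Finset.range n, 1 / ((j : ℝ) + 1) ≤ 1 + Real.log n := by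
  have h := harmonic_le_one_add_log n
  simpa [harmonic, one_div] using h

/-! ### Products of increments of the two semigroups -/

/-- Both semigroups smooth, so that the loss after `j` steps is quadratic. -/
theorem exists_norm_increments_le [CompleteSpace X] {A B : X →ₗ.[ℂ] X} {SA SB : ℝ → X →L[ℂ] X}
    (hA : GeneratesAnalyticSemigroup A SA) (hB : GeneratesAnalyticSemigroup B SB)
    (hcomm : ∀ t : ℝ, 0 ≤ t → (SA t).comp (SB t) = (SB t).comp (SA t)) (T : ℝ) :
    ∃ C : ℝ, 0 ≤ C ∧ ∀ τ : ℝ, 0 < τ → ∀ j : ℕ, (j + 1) * τ ≤ T → ∀ x : X,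
      ∀ s ∈ Icc 0 τ, ∀ r ∈ Icc 0 τ,
        ‖(SA (j * τ)).comp (SB (j * τ)) ((SA s - SA r) ((SB s - SB r) x))‖ ≤
          C * (1 / ((j : ℝ) + 1) ^ 2) * ‖x‖ := by
  obtain ⟨CA, hCA0, hCA⟩ := hA.exists_norm_comp_sub_le T
  obtain ⟨CB, hCB0, hCB⟩ := hB.exists_norm_comp_sub_le T
  refine ⟨CA * CB, by positivity, fun τ hτ j hj x s hs r hr => ?_⟩
  have hjτ : 0 ≤ j * τ := by positivity
  have e : (SA (j * τ)).comp (SB (j * τ)) ((SA s - SA r) ((SB s - SB r) x)) =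
      (SA (j * τ)).comp (SA s - SA r) ((SB (j * τ)).comp (SB s - SB r) x) := by
    simp only [ContinuousLinearMap.comp_apply, sub_apply, map_sub]
    simp only [hA.1.commute hB.1 hcomm hs.1 hjτ, hA.1.commute hB.1 hcomm hr.1 hjτ]
  rw [e]
  calc _ ≤ CA / (j + 1) * (CB / (j + 1) * ‖x‖) :=
        ContinuousLinearMap.le_of_opNorm_le_of_le _ (hCA τ hτ j hj s hs r hr)
          (ContinuousLinearMap.le_of_opNorm_le _ (hCB τ hτ j hj s hs r hr) x)
    _ = _ := by field_simp

/-- For `x ∈ D(A)` the increment of `exp (t A)` gains `τ` and only the other one has to be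
smoothed. -/
theorem exists_norm_increments_le_of_mem_domain [CompleteSpace X] {A B : X →ₗ.[ℂ] X}
    {SA SB : ℝ → X →L[ℂ] X} (hA : GeneratesAnalyticSemigroup A SA)
    (hB : GeneratesAnalyticSemigroup B SB)
    (hcomm : ∀ t : ℝ, 0 ≤ t → (SA t).comp (SB t) = (SB t).comp (SA t)) (T : ℝ) :
    ∃ C : ℝ, 0 ≤ C ∧ ∀ τ : ℝ, 0 < τ → ∀ j : ℕ, (j + 1) * τ ≤ T → ∀ x : A.domain,
      ∀ s ∈ Icc 0 τ, ∀ r ∈ Icc 0 τ,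
        ‖(SA (j * τ)).comp (SB (j * τ)) ((SA s - SA r) ((SB s - SB r) (x : X)))‖ ≤
          C * τ * (1 / ((j : ℝ) + 1)) * ‖A x‖ := by
  obtain ⟨MA, hMA⟩ := hA.1.exists_norm_le T
  obtain ⟨CB, hCB0, hCB⟩ := hB.exists_norm_comp_sub_le T
  refine ⟨CB * |MA|, by positivity, fun τ hτ j hj x s hs r hr => ?_⟩
  have hjτ : 0 ≤ j * τ := by positivity
  have hjT : j * τ + τ ≤ T := by linarith
  have hgen := (hA.2.1 x (A x)).1 ⟨x.2, rfl⟩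
  have e : (SA (j * τ)).comp (SB (j * τ)) ((SA s - SA r) ((SB s - SB r) (x : X))) =
      (SB (j * τ)).comp (SB s - SB r) (SA (j * τ) ((SA s - SA r) (x : X))) := by
    simp only [ContinuousLinearMap.comp_apply, sub_apply, map_sub]
    simp only [hA.1.commute hB.1 hcomm hjτ hjτ, hA.1.commute hB.1 hcomm hjτ hs.1,
      hA.1.commute hB.1 hcomm hjτ hr.1, hA.1.commute hB.1 hcomm hs.1 hs.1,
      hA.1.commute hB.1 hcomm hs.1 hr.1, hA.1.commute hB.1 hcomm hr.1 hs.1,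
      hA.1.commute hB.1 hcomm hr.1 hr.1]
    abel
  have h1 : ‖SA (j * τ) ((SA s - SA r) (x : X))‖ ≤ |MA| * ‖A x‖ * τ := by
    refine hA.1.norm_apply_sub_le hgen _ (fun σ hσ => ?_) hs hr
    rw [← hA.1.apply_add hjτ hσ.1]
    exact ContinuousLinearMap.le_of_opNorm_le _ ((hMA _ ⟨by linarith [hσ.1],
      by linarith [hσ.2]⟩).trans (le_abs_self _)) _
  rw [e]
  calc _ ≤ CB / (j + 1) * (|MA| * ‖A x‖ * τ) :=
        ContinuousLinearMap.le_of_opNorm_le_of_le _ (hCB τ hτ j hj s hs r hr) h1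
    _ = _ := by ring

/-- For `x ∈ D(BA)` both increments gain a factor `τ`. -/
theorem exists_norm_increments_le_of_mem_domain_comp [CompleteSpace X] {A B : X →ₗ.[ℂ] X}
    {SA SB : ℝ → X →L[ℂ] X} (hA : GeneratesAnalyticSemigroup A SA)
    (hB : GeneratesAnalyticSemigroup B SB)
    (hcomm : ∀ t : ℝ, 0 ≤ t → (SA t).comp (SB t) = (SB t).comp (SA t)) (T : ℝ) :
    ∃ C : ℝ, 0 ≤ C ∧ ∀ τ : ℝ, 0 < τ → ∀ j : ℕ, (j + 1) * τ ≤ T → ∀ x : A.domain,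
      ∀ hx : A x ∈ B.domain, ∀ s ∈ Icc 0 τ, ∀ r ∈ Icc 0 τ,
        ‖(SA (j * τ)).comp (SB (j * τ)) ((SA s - SA r) ((SB s - SB r) (x : X)))‖ ≤
          C * τ ^ 2 * ‖B ⟨A x, hx⟩‖ := by
  obtain ⟨MA, hMA⟩ := hA.1.exists_norm_le T
  obtain ⟨MB, hMB⟩ := hB.1.exists_norm_le T
  refine ⟨|MA| * |MB|, by positivity, fun τ hτ j hj x hx s hs r hr => ?_⟩
  have hjτ : 0 ≤ j * τ := by positivity
  have hjT : j * τ + τ ≤ T := by linarith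
  have hgenA := (hA.2.1 x (A x)).1 ⟨x.2, rfl⟩
  have hgenB := (hB.2.1 (A x) (B ⟨A x, hx⟩)).1 ⟨hx, rfl⟩
  have hc : ∀ a : ℝ, 0 ≤ a → ∀ z, (SB s - SB r) (SA a z) = SA a ((SB s - SB r) z) :=
    fun a ha z => by
      simp only [sub_apply, map_sub, hA.1.commute hB.1 hcomm ha hs.1,
        hA.1.commute hB.1 hcomm ha hr.1]
  have e : (SA (j * τ)).comp (SB (j * τ)) ((SA s - SA r) ((SB s - SB r) (x : X))) =
      ((SA (j * τ)).comp (SB (j * τ))).comp (SB s - SB r) ((SA s - SA r) (x : X)) := by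
    rw [ContinuousLinearMap.comp_apply _ (SB s - SB r), sub_apply (SA s), sub_apply (SA s),
      map_sub (SB s - SB r), hc s hs.1, hc r hr.1]
  rw [e]
  have hmain := hA.1.norm_apply_sub_le hgenA (((SA (j * τ)).comp (SB (j * τ))).comp (SB s - SB r))
    (τ := τ) (K := |MA| * (|MB| * ‖B ⟨A x, hx⟩‖ * τ)) (fun σ hσ => by
      have e2 : (((SA (j * τ)).comp (SB (j * τ))).comp (SB s - SB r)) (SA σ (A x)) =
          SA (j * τ + σ) (SB (j * τ) ((SB s - SB r) (A x))) := by
        simp only [ContinuousLinearMap.comp_apply]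
        rw [hc σ hσ.1, ← hA.1.commute hB.1 hcomm hσ.1 hjτ, ← hA.1.apply_add hjτ hσ.1]
      rw [e2]
      refine ContinuousLinearMap.le_of_opNorm_le_of_le _ ((hMA _ ⟨by linarith [hσ.1],
        by linarith [hσ.2]⟩).trans (le_abs_self _)) ?_
      refine hB.1.norm_apply_sub_le hgenB _ (fun ρ hρ => ?_) hs hr
      rw [← hB.1.apply_add hjτ hρ.1]
      exact ContinuousLinearMap.le_of_opNorm_le _ ((hMB _ ⟨by linarith [hρ.1],
        by linarith [hρ.2]⟩).trans (le_abs_self _)) _) hs hr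
  refine hmain.trans_eq ?_
  ring

/-! ### The global error -/

/-- Global error bound in terms of bounds `β j` for the defect of `φ_1` after `j` steps. The defect
of `φ_2` acts on increments of `g (u t)`, which are `O(τ)`; by smoothing it contributes
`τ^2 * ∑ (j + 1)^(-2)`, whatever the domain conditions. -/
theorem exists_norm_global_error_le [CompleteSpace X] {A B : X →ₗ.[ℂ] X}
    {SA SB : ℝ → X →L[ℂ] X} (hA : GeneratesAnalyticSemigroup A SA)
    (hB : GeneratesAnalyticSemigroup B SB)
    (hcomm : ∀ t : ℝ, 0 ≤ t → (SA t).comp (SB t) = (SB t).comp (SA t))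
    {g : X → X} (hg : TwiceDiffBounded g) {T : ℝ} (hT : 0 < T) {u₀ : X} {u : ℝ → X}
    (hu : IsSolution (A + B) g T u₀ u) (hu2 : ContDiffOn ℝ 2 u (Icc 0 T)) :
    ∃ G : ℝ, 0 ≤ G ∧ ∀ τ : ℝ, 0 < τ → ∀ n : ℕ, 0 < n → n * τ ≤ T → ∀ β : ℕ → ℝ,
      (∀ j : ℕ, (j + 1) * τ ≤ T → ∀ t ∈ Icc 0 T,
        ‖(SA (j * τ)).comp (SB (j * τ)) (splitDefect SA SB 0 τ (g (u t)))‖ ≤ β j) →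
      ‖erk2l SA SB g τ u₀ n - u (n * τ)‖ ≤
        G * (τ * ∑ j ∈ Finset.range n, β j + τ * β 0 + τ ^ 2) := by
  have hP := hA.1.comp hB.1 hcomm
  obtain ⟨M, hM⟩ := hP.exists_norm_le T
  have hM0 : 0 ≤ M := (norm_nonneg _).trans (hM 0 ⟨le_rfl, hT.le⟩)
  obtain ⟨hu0, hu⟩ := hu
  have hgen : ∀ t ∈ Icc 0 T,
      Tendsto (fun h : ℝ => h⁻¹ • ((SA h).comp (SB h) (u t) - u t)) (𝓝[>] 0)
        (𝓝 (derivWithin u (Icc 0 T) t - g (u t))) := by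
    intro t ht
    obtain ⟨hut, hd⟩ := hu t ht
    rw [hd.derivWithin (uniqueDiffOn_Icc hT t ht), add_sub_cancel_right, LinearPMap.add_apply]
    exact tendsto_comp_generator hA.1 ((hA.2.1 _ _).1 ⟨hut.1, rfl⟩) ((hB.2.1 _ _).1 ⟨hut.2, rfl⟩)
  have hder : ∀ t ∈ Icc 0 T, HasDerivWithinAt u
      (derivWithin u (Icc 0 T) t - g (u t) + g (u t)) (Icc 0 T) t := by
    intro t ht
    obtain ⟨hut, hd⟩ := hu t ht
    rw [sub_add_cancel]
    exact hd.differentiableWithinAt.hasDerivWithinAt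
  obtain ⟨CL, hCL0, hCL⟩ := exists_norm_local_error_le hA.1 hB.1 hcomm hg hT hgen hder hu2
  obtain ⟨f', Kf, hKf0, -, hKf, -⟩ := hg.comp_regularity hT hu2
  obtain ⟨CI, hCI0, hCI⟩ := exists_norm_increments_le hA hB hcomm T
  obtain ⟨Λ, hΛ0, hΛ⟩ : ∃ Λ : ℝ, 0 ≤ Λ ∧ ∀ τ : ℝ, 0 < τ → τ ≤ T → ∀ v w : X,
      ‖step SA SB g τ v - step SA SB g τ w - (SA τ).comp (SB τ) (v - w)‖ ≤ Λ * τ * ‖v - w‖ := by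
    obtain ⟨hg1, -, ⟨K, hK⟩, -⟩ := hg
    exact exists_norm_step_sub_le hA.1 hB.1 (fun x y =>
      Convex.norm_image_sub_le_of_norm_fderiv_le (fun z _ => hg1 z) (fun z _ => hK z) convex_univ
        (mem_univ y) (mem_univ x)) ((norm_nonneg _).trans (hK 0)) hT
  refine ⟨(1 + 4 * CI * Kf + T * (M * CL)) * Real.exp (T * (M * Λ)), by positivity,
    fun τ hτ n hn hnτ β hβ => ?_⟩
  have hjT : ∀ j < n, ((j : ℝ) + 1) * τ ≤ T := fun j hj => by
    refine le_trans (mul_le_mul_of_nonneg_right ?_ hτ.le) hnτ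
    exact_mod_cast hj
  have hgrid : ∀ k < n, (k : ℝ) * τ ∈ Icc 0 T ∧ k * τ + τ ∈ Icc 0 T := fun k hk => by
    have h1 := hjT k hk
    have h2 : 0 ≤ k * τ := by positivity
    exact ⟨⟨h2, by linarith⟩, ⟨by linarith, by linarith⟩⟩
  have hτT : τ ≤ T := by simpa using hjT 0 hn
  have h0T : (0 : ℝ) ∈ Icc 0 T := ⟨le_rfl, hT.le⟩
  have hβ0' : ∀ j < n, 0 ≤ β j := fun j hj => (norm_nonneg _).trans (hβ j (hjT j hj) 0 h0T)
  have hβ0 : 0 ≤ β 0 := hβ0' 0 hn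
  have hD0 : ∀ t ∈ Icc 0 T, ‖splitDefect SA SB 0 τ (g (u t))‖ ≤ β 0 := fun t ht => by
    simpa [hA.1.zero, hB.1.zero] using hβ 0 (by simpa using hτT) t ht
  set p := (SA τ).comp (SB τ) with hp
  have hpow : ∀ j : ℕ, p ^ j = (SA (j * τ)).comp (SB (j * τ)) := fun j =>
    (hP.natCast_mul hτ.le j).symm
  -- `e k` is the global error and `γ j` bounds a local error after `j` further steps.
  let e : ℕ → X := fun k => erk2l SA SB g τ u₀ k - u (k * τ)
  let γ : ℕ → ℝ := fun j => τ * β j + 2 * CI * Kf * τ ^ 2 * (1 / ((j : ℝ) + 1) ^ 2) +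
    M * CL * τ ^ 2 * (β 0 + τ)
  have hmain := norm_le_of_error_recursion (p := p) (e := e) (N := n) (M := M) (q := Λ * τ)
    (r := fun k => step SA SB g τ (erk2l SA SB g τ u₀ k) - step SA SB g τ (u (k * τ)) - p (e k))
    (δ := fun k => step SA SB g τ (u (k * τ)) - u (k * τ + τ)) (γ := γ) hM0 (by positivity)
    (by simp [e, erk2l, hu0])
    (fun k _ => by
      have : ((k + 1 : ℕ) : ℝ) * τ = k * τ + τ := by push_cast; ring
      simp only [e, erk2l, this]
      abel)
    (fun j hj => by rw [hpow]; exact hM _ (hgrid j hj).1)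
    (fun k _ => hΛ τ hτ hτT _ _)
    (fun j hj k hk => by
      obtain ⟨hk1, hk2⟩ := hgrid k hk
      have hloc := hCL (k * τ) τ hk1.1 hτ hk2.2
      set D1 := splitDefect SA SB 0 τ (g (u (k * τ))) with hD1
      set d := g (u (k * τ + τ)) - g (u (k * τ)) with hd
      set D2 := splitDefect SA SB 1 τ d with hD2
      set ρ := step SA SB g τ (u (k * τ)) - u (k * τ + τ) - τ • D1 - τ • D2 with hρ
      have hdn : ‖d‖ ≤ Kf * τ := by
        have := hKf _ hk2 _ hk1
        rwa [add_sub_cancel_left, abs_of_pos hτ] at this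
      have e1 : step SA SB g τ (u (k * τ)) - u (k * τ + τ) = τ • D1 + τ • D2 + ρ := by
        rw [hρ]; abel
      have n1 : ‖(p ^ j) D1‖ ≤ β j := by rw [hpow]; exact hβ j (hjT j hj) _ hk1
      have n2 : ‖(p ^ j) D2‖ ≤ 2 * (CI * (1 / ((j : ℝ) + 1) ^ 2) * (Kf * τ)) := by
        rw [hpow]
        refine norm_splitDefect_le hA.1 hB.1 hcomm 1 hτ.le _ d fun s hs r hr => ?_
        refine (hCI τ hτ j (hjT j hj) d s hs r hr).trans ?_
        gcongr
      have n3 : ‖(p ^ j) ρ‖ ≤ M * (CL * τ ^ 2 * (β 0 + τ)) := by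
        rw [hpow]
        refine ContinuousLinearMap.le_of_opNorm_le_of_le _ (hM _ (hgrid j hj).1) (hloc.trans ?_)
        have := hD0 _ hk1
        gcongr
      simp only [e1, map_add, ContinuousLinearMap.map_smul_of_tower]
      calc _ ≤ ‖τ • (p ^ j) D1‖ + ‖τ • (p ^ j) D2‖ + ‖(p ^ j) ρ‖ := norm_add₃_le
        _ ≤ τ * β j + τ * (2 * (CI * (1 / ((j : ℝ) + 1) ^ 2) * (Kf * τ))) +
            M * (CL * τ ^ 2 * (β 0 + τ)) := by
            rw [norm_smul, norm_smul, Real.norm_of_nonneg hτ.le]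
            gcongr
        _ = γ j := by simp only [γ]; ring)
  have hS0 : 0 ≤ ∑ j ∈ Finset.range n, β j :=
    Finset.sum_nonneg fun j hj => hβ0' j (Finset.mem_range.1 hj)
  have hsum : ∑ j ∈ Finset.range n, γ j ≤ (1 + 4 * CI * Kf + T * (M * CL)) *
      (τ * ∑ j ∈ Finset.range n, β j + τ * β 0 + τ ^ 2) := by
    simp only [γ]
    rw [Finset.sum_add_distrib, Finset.sum_add_distrib, ← Finset.mul_sum, ← Finset.mul_sum,
      Finset.sum_const, Finset.card_range, nsmul_eq_mul]
    set S := ∑ j ∈ Finset.range n, β j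
    have h1 : 2 * CI * Kf * τ ^ 2 * ∑ j ∈ Finset.range n, 1 / ((j : ℝ) + 1) ^ 2 ≤
        2 * CI * Kf * τ ^ 2 * 2 :=
      mul_le_mul_of_nonneg_left (sum_range_inv_sq_le n) (by positivity)
    have h2 : n * (M * CL * τ ^ 2 * (β 0 + τ)) ≤ T * (M * CL) * (τ * β 0 + τ ^ 2) := by
      have : n * τ * (M * CL * τ * (β 0 + τ)) ≤ T * (M * CL * τ * (β 0 + τ)) :=
        mul_le_mul_of_nonneg_right hnτ (by positivity)
      linarith
    have h3 : 0 ≤ (4 * CI * Kf + T * (M * CL)) * (τ * S) := by positivity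
    have h4 : 0 ≤ (1 + 4 * CI * Kf) * (τ * β 0) + τ ^ 2 := by positivity
    linarith
  refine hmain.trans ?_
  have hexp : Real.exp (n * (M * (Λ * τ))) ≤ Real.exp (T * (M * Λ)) := by
    refine Real.exp_le_exp.2 ?_
    have := mul_le_mul_of_nonneg_right hnτ (mul_nonneg hM0 hΛ0)
    linarith
  calc _ ≤ ((1 + 4 * CI * Kf + T * (M * CL)) *
        (τ * ∑ j ∈ Finset.range n, β j + τ * β 0 + τ ^ 2)) * Real.exp (T * (M * Λ)) := by
        gcongr
    _ = _ := by ring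

theorem one_add_log_natCast_le {T τ : ℝ} (hτ : 0 < τ) {n : ℕ} (hn : 0 < n) (hnτ : n * τ ≤ T) :
    1 + Real.log n ≤ (1 + |Real.log T|) * (1 + |Real.log τ|) := by
  have hn' : (0 : ℝ) < n := by exact_mod_cast hn
  have h1 := Real.log_le_log (by positivity) hnτ
  rw [Real.log_mul hn'.ne' hτ.ne'] at h1
  have h2 := le_abs_self (Real.log T)
  have h3 := neg_abs_le (Real.log τ)
  have h4 : 0 ≤ |Real.log T| * |Real.log τ| := by positivity
  linarith

end SplitExp

theorem mainTheorem1 {X : Type*} [NormedAddCommGroup X] [NormedSpace ℂ X] [CompleteSpace X]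
    (A B : X →ₗ.[ℂ] X) (SA SB SAB : ℝ → X →L[ℂ] X)
    (hA : SplitExp.GeneratesAnalyticSemigroup A SA)
    (hB : SplitExp.GeneratesAnalyticSemigroup B SB)
    (hAB : SplitExp.GeneratesAnalyticSemigroup (A + B) SAB)
    (hcomm : ∀ t : ℝ, 0 ≤ t → (SA t).comp (SB t) = (SB t).comp (SA t))
    (g : X → X) (hg : SplitExp.TwiceDiffBounded g)
    (T : ℝ) (hT : 0 < T) (u₀ : X) (u : ℝ → X)
    (hu : SplitExp.IsSolution (A + B) g T u₀ u)
    (hu_smooth : ContDiffOn ℝ 2 u (Set.Icc 0 T)) :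
    (SplitExp.BoundedInDomainComp B A T (fun t => g (u t)) →
      ∃ C : ℝ, ∀ τ : ℝ, 0 < τ → ∀ n : ℕ, n * τ ≤ T →
        ‖SplitExp.erk2l SA SB g τ u₀ n - u (n * τ)‖ ≤ C * τ ^ 2) ∧
    (SplitExp.BoundedInDomain A T (fun t => g (u t)) →
      ∃ C : ℝ, ∀ τ : ℝ, 0 < τ → ∀ n : ℕ, n * τ ≤ T →
        ‖SplitExp.erk2l SA SB g τ u₀ n - u (n * τ)‖ ≤ C * τ ^ 2 * (1 + |Real.log τ|)) ∧
    (∃ C : ℝ, ∀ τ : ℝ, 0 < τ → ∀ n : ℕ, n * τ ≤ T →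
        ‖SplitExp.erk2l SA SB g τ u₀ n - u (n * τ)‖ ≤ C * τ) := by
  obtain ⟨G, hG0, hG⟩ := SplitExp.exists_norm_global_error_le hA hB hcomm hg hT hu hu_smooth
  have hzero : ∀ τ : ℝ, ‖SplitExp.erk2l SA SB g τ u₀ 0 - u ((0 : ℕ) * τ)‖ = 0 := fun τ => by
    simp [SplitExp.erk2l, hu.1]
  -- The bounds are claimed for all `τ > 0`, but `τ > T` leaves only `n = 0`.
  have hτT : ∀ {τ : ℝ}, 0 < τ → ∀ {n : ℕ}, 0 < n → n * τ ≤ T → τ ≤ T := fun {τ} hτ {n} hn h => by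
    have : (1 : ℝ) ≤ n := by exact_mod_cast hn
    exact (le_mul_of_one_le_left hτ.le this).trans h
  refine ⟨?_, ?_, ?_⟩
  · rintro ⟨N, hN⟩
    obtain ⟨C, hC0, hC⟩ :=
      SplitExp.exists_norm_increments_le_of_mem_domain_comp hA hB hcomm T
    refine ⟨G * (2 * (C * |N|) * T + 2 * (C * |N|) * T + 1), fun τ hτ n hn => ?_⟩
    rcases Nat.eq_zero_or_pos n with rfl | hn0
    · rw [hzero]; positivity
    refine (hG τ hτ n hn0 hn (fun _ => 2 * (C * τ ^ 2 * |N|)) fun j hj t ht => ?_).trans ?_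
    · obtain ⟨h1, h2, h3⟩ := hN t ht
      refine SplitExp.norm_splitDefect_le hA.1 hB.1 hcomm 0 hτ.le _ _ fun s hs r hr => ?_
      refine (hC τ hτ j hj ⟨_, h1⟩ h2 s hs r hr).trans ?_
      have := h3.trans (le_abs_self N)
      gcongr
    · rw [Finset.sum_const, Finset.card_range, nsmul_eq_mul, mul_assoc G]
      refine mul_le_mul_of_nonneg_left ?_ hG0
      have hE : 0 ≤ 2 * (C * |N|) * τ ^ 2 := by positivity
      have h1 := mul_le_mul_of_nonneg_right hn hE
      have h2 := mul_le_mul_of_nonneg_right (hτT hτ hn0 hn) hE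
      linarith
  · rintro ⟨N, hN⟩
    obtain ⟨C, hC0, hC⟩ := SplitExp.exists_norm_increments_le_of_mem_domain hA hB hcomm T
    refine ⟨G * (2 * (C * |N|) * (1 + |Real.log T|) + 2 * (C * |N|) + 1), fun τ hτ n hn => ?_⟩
    rcases Nat.eq_zero_or_pos n with rfl | hn0
    · rw [hzero]; positivity
    refine (hG τ hτ n hn0 hn (fun j => 2 * (C * τ * |N|) * (1 / ((j : ℝ) + 1)))
      fun j hj t ht => ?_).trans ?_
    · obtain ⟨h1, h3⟩ := hN t ht
      refine (SplitExp.norm_splitDefect_le hA.1 hB.1 hcomm 0 hτ.le _ _ (fun s hs r hr =>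
        (hC τ hτ j hj ⟨_, h1⟩ s hs r hr).trans
          (mul_le_mul_of_nonneg_left (h3.trans (le_abs_self N)) (by positivity)))).trans_eq ?_
      ring
    · rw [← Finset.mul_sum, mul_assoc G, mul_assoc G]
      refine mul_le_mul_of_nonneg_left ?_ hG0
      have hE : 0 ≤ 2 * (C * |N|) * τ ^ 2 := by positivity
      have hlog := (SplitExp.sum_range_inv_le n).trans (SplitExp.one_add_log_natCast_le hτ hn0 hn)
      have h1 := mul_le_mul_of_nonneg_left hlog hE
      have h2 : 0 ≤ (2 * (C * |N|) + 1) * τ ^ 2 * |Real.log τ| := by positivity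
      norm_num
      norm_num at h1
      linarith
  · obtain ⟨C, hC0, hC⟩ := SplitExp.exists_norm_increments_le hA hB hcomm T
    obtain ⟨N, hN⟩ : ∃ N : ℝ, ∀ t ∈ Set.Icc 0 T, ‖g (u t)‖ ≤ N :=
      isCompact_Icc.exists_bound_of_continuousOn
        (hg.1.continuous.comp_continuousOn hu_smooth.continuousOn)
    refine ⟨G * (4 * (C * |N|) + 2 * (C * |N|) + T), fun τ hτ n hn => ?_⟩
    rcases Nat.eq_zero_or_pos n with rfl | hn0
    · rw [hzero]; positivity
    refine (hG τ hτ n hn0 hn (fun j => 2 * (C * |N|) * (1 / ((j : ℝ) + 1) ^ 2))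
      fun j hj t ht => ?_).trans ?_
    · refine (SplitExp.norm_splitDefect_le hA.1 hB.1 hcomm 0 hτ.le _ _ (fun s hs r hr =>
        (hC τ hτ j hj _ s hs r hr).trans
          (mul_le_mul_of_nonneg_left ((hN t ht).trans (le_abs_self N))
            (by positivity)))).trans_eq ?_
      ring
    · rw [← Finset.mul_sum, mul_assoc G]
      refine mul_le_mul_of_nonneg_left ?_ hG0
      have hE : 0 ≤ 2 * (C * |N|) * τ := by positivity
      have h1 := mul_le_mul_of_nonneg_left (SplitExp.sum_range_inv_sq_le n) hE
      have h2 := mul_le_mul_of_nonneg_right (hτT hτ hn0 hn) hτ.le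
      norm_num
      norm_num at h1
      linarith
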